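/- Let $R$ be a commutative ring and $M$ an $R$-bimodule. For a ring $S$ let $\mathcal{B}(R,S)$ be the abelian category of functors $F$ from finitely generated projective $R$-modules to left $S$-modules with $F(0)=0$, and put $\mathcal{B}(R)=\mathcal{B}(R,R)$. Let $\mathsf{I}\in\mathcal{B}(R)$ be the tautological embedding, and $\mathsf{I}(M)(V)=M\otimes_R V$. An elementary extension of $R$ by $M$ is an exact sequence $$0\to \mathsf{I}(M)\xrightarrow{\,b\,} C_1\xrightarrow{\,d\,} C_0\xrightarrow{\,a\,}\mathsf{I}\to 0$$ in $\mathcal{B}(R)$. For commutative $S$, a multiplicative structure on a complex $F_\bullet$ in $\mathcal{B}(R,S)$ consists of a unit map $S\to F_0(R)$ and functorial maps of complexes $F_\bullet(V)\otimes_S F_\bullet(V')\to F_\bullet(V\otimes_R V')$, associative and unital. The extension $\phi=\langle C_\bullet,a,b\rangle$ is multiplicative if $C_\bullet=(C_1\xrightarrow{d}C_0)$ is equipped with a multiplicative structure such that $a:C_\bullet\to\mathsf{I}$ is multiplicative. For a ring map $f:S\to R$, restriction of scalars of the values gives an exact sequence $f_*(\phi)$ in $\mathcal{B}(R,S)$,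 multiplicative (with the same products) if $\phi$ is and $S$ is commutative. A splitting of $f_*(\phi)$ is a functor $C_{01}\in\mathcal{B}(R,S)$ with maps $c_1:f_*C_1\to C_{01}$ and $c_0:C_{01}\to f_*C_0$ such that $c_0$ is surjective, $c_0c_1=d$, and $c_1$ identifies $f_*C_1$ with $c_0^{-1}(\operatorname{Im} d)$. A multiplicative structure on this splitting is a multiplicative structure on the complex $C_1\xrightarrow{c_1}C_{01}$ (with $C_{01}$ in degree $0$) for which the map of complexes $(\mathrm{id},c_0)$ to $(C_1\xrightarrow{d}C_0)$ is multiplicative. Let $\phi$ be a multiplicative elementary extension of $R$ by $M$, and let $e:\mathbb{Z}\to R$ be the unique ring map. Then $e_*(\phi)$ admits a splitting, and for every splitting $\langle C_{01},c_0,c_1\rangle$ of $e_*(\phi)$ the following holds. Let $R'\subset\operatorname{End}(C_{01})$ be the ring of all endomorphisms $r'$ such that, for some (necessarily unique) $r\in R$, one has $r'c_1=c_1 r$ and $c_0r'=r\,c_0$. Let $q:R'\to R$, $r'\mapsto r$, and let $i:M\to R'$ send $m$ to the composition of $a\circ c_0:C_{01}\to\mathsf{I}$, of $v\mapsto m\otimes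 v$, and of $c_1\circ b:\mathsf{I}(M)\to C_{01}$. Then: 1. $0\to M\xrightarrow{\,i\,}R'\xrightarrow{\,q\,}R\to0$ is a square-zero extension of $R$ by the bimodule $M$, that is, the sequence is exact, $i(m)r'=i(m\,q(r'))$, $r'i(m)=i(q(r')m)$ and $i(m)i(m')=0$ for all $m,m'\in M$, $r'\in R'$. 2. The ring $R'$ is commutative. 3. The splitting $C_{01}$ of $e_*(\phi)$ admits a multiplicative structure; and every multiplicative structure on it extends to $q_*(\phi)$: the functor $C_{01}$, with the tautological action of $R'$ on its values, is a splitting of $q_*(\phi)$ in $\mathcal{B}(R,R')$ with the same maps $c_0$, $c_1$, and it carries a multiplicative structure over $R'$ with the same products and the same unit element of $C_{01}(R)$. -/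

import Mathlib

open CategoryTheory MonoidalCategory MulOpposite
open scoped TensorProduct

universe u w

noncomputable section

/-! ### Finitely generated projective modules and functors on them -/

section Functors

/-- The property of being a finitely generated projective module. -/
def fgProj (R : Type u) [CommRing R] : ObjectProperty (ModuleCat.{u} R) :=
  fun V => Module.Finite R V ∧ Module.Projective R V

instance fgProj_isMonoidal (R : Type u) [CommRing R] : (fgProj R).IsMonoidal where
  prop_unit := ⟨inferInstanceAs (Module.Finite R R), inferInstanceAs (Module.Projective R R)⟩
  prop_tensor := by
    rintro V W ⟨hV, hV'⟩ ⟨hW, hW'⟩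
    exact ⟨inferInstanceAs (Module.Finite R (V ⊗[R] W)),
      inferInstanceAs (Module.Projective R (V ⊗[R] W))⟩

/-- The tensor category `R-proj` of finitely generated projective modules over a commutative
ring `R`. Its unit object `𝟙_` is `R`. -/
abbrev FGProj (R : Type u) [CommRing R] := (fgProj R).FullSubcategory

/-- Functors from `R-proj` to left `S`-modules. -/
abbrev ProjFunctor (R : Type u) [CommRing R] (S : Type w) [Ring S] :=
  FGProj R ⥤ ModuleCat.{u} S

variable {R : Type u} [CommRing R]

/-- A functor is pointed if it sends zero modules to zero modules. The pointed functors
`R-proj ⥤ S-mod` are the objects of the category `B(R, S)`; a sequence of them is exact if and only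
if it is exact at every object of `R-proj`. -/
def IsPointed {S : Type w} [Ring S] (F : ProjFunctor R S) : Prop :=
  ∀ V : FGProj R, Subsingleton V.obj → Subsingleton (F.obj V)

/-- Postcomposition with restriction of scalars along `f : S' → S`. -/
abbrev restr {S : Type*} [Ring S] {S' : Type*} [Ring S'] (f : S' →+* S)
    (F : ProjFunctor R S) : ProjFunctor R S' :=
  F ⋙ ModuleCat.restrictScalars f

/-- The effect of restriction of scalars on a natural transformation. -/
abbrev restrMap {S : Type*} [Ring S] {S' : Type*} [Ring S'] (f : S' →+* S)
    {F G : ProjFunctor R S} (t : F ⟶ G) : restr f F ⟶ restr f G :=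
  Functor.whiskerRight t (ModuleCat.restrictScalars f)

variable (R) in
/-- The tautological embedding `I : R-proj ⥤ R-mod`. -/
abbrev tautFunctor : ProjFunctor R R := (fgProj R).ι

/-- A module over the commutative ring `R`, considered as a module over `Rᵐᵒᵖ`. -/
abbrev opModule (V : ModuleCat.{u} R) : ModuleCat.{u} Rᵐᵒᵖ :=
  (ModuleCat.restrictScalars ((RingEquiv.toOpposite R).symm : Rᵐᵒᵖ →+* R)).obj V

section Bimodule

variable (M : Type u) [AddCommGroup M] [Module R M] [Module Rᵐᵒᵖ M]

/-- The tensor product `M ⊗_R V` of an `R`-bimodule `M` and an `R`-module `V`: the tensor product is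
formed with respect to the right action of `R` on `M`. -/
abbrev BimodTensor (V : ModuleCat.{u} R) : Type u := M ⊗[Rᵐᵒᵖ] (opModule V)

/-- The element `m ⊗ v` of `M ⊗_R V`. -/
abbrev bimodTmul {V : ModuleCat.{u} R} (m : M) (v : V) : BimodTensor M V :=
  TensorProduct.tmul Rᵐᵒᵖ (N := opModule V) m v

variable [SMulCommClass R Rᵐᵒᵖ M]

/-- The left `R`-module structure on `M ⊗_R V`, `r • (m ⊗ v) = (r • m) ⊗ v`. -/
instance bimodTensorModule (V : ModuleCat.{u} R) : Module R (BimodTensor M V) :=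
  haveI : SMulCommClass Rᵐᵒᵖ R M := SMulCommClass.symm R Rᵐᵒᵖ M
  TensorProduct.leftModule

theorem smul_bimodTmul {V : ModuleCat.{u} R} (r : R) (m : M) (v : V) :
    r • bimodTmul M m v = bimodTmul M (r • m) v :=
  haveI : SMulCommClass Rᵐᵒᵖ R M := SMulCommClass.symm R Rᵐᵒᵖ M
  TensorProduct.smul_tmul' r m _

/-- The map `m ⊗ v ↦ m ⊗ g(v)`. -/
def bimodMap {V W : ModuleCat.{u} R} (g : V ⟶ W) : BimodTensor M V →ₗ[R] BimodTensor M W where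
  toFun := LinearMap.lTensor M
    ((ModuleCat.restrictScalars ((RingEquiv.toOpposite R).symm : Rᵐᵒᵖ →+* R)).map g).hom
  map_add' := map_add _
  map_smul' r x := by
    induction x using TensorProduct.induction_on with
    | zero => simp
    | tmul m v => exact congrArg _ (smul_bimodTmul M r m v)
    | add x y hx hy => rw [smul_add, map_add, hx, hy, map_add, smul_add]

variable (R) in
/-- The functor `I(M)`, `V ↦ M ⊗_R V`, of an `R`-bimodule `M`. -/
def bimodFunctor : ProjFunctor R R where
  obj V := ModuleCat.of R (BimodTensor M V.obj)
  map g := ModuleCat.ofHom (bimodMap M g.hom)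
  map_id V := by
    refine ModuleCat.hom_ext (LinearMap.ext fun x => ?_)
    exact LinearMap.congr_fun (LinearMap.lTensor_id M (opModule V.obj)) x
  map_comp {U V W} f g := by
    refine ModuleCat.hom_ext (LinearMap.ext fun x => ?_)
    exact LinearMap.congr_fun (LinearMap.lTensor_comp (R := Rᵐᵒᵖ) M
      ((ModuleCat.restrictScalars ((RingEquiv.toOpposite R).symm : Rᵐᵒᵖ →+* R)).map g.hom).hom
      ((ModuleCat.restrictScalars ((RingEquiv.toOpposite R).symm : Rᵐᵒᵖ →+* R)).map f.hom).hom) x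

/-- The map `v ↦ m ⊗ v` from `V` to `I(M)(V) = M ⊗_R V`. -/
def bimodMk {M : Type u} [AddCommGroup M] [Module R M] [Module Rᵐᵒᵖ M] [SMulCommClass R Rᵐᵒᵖ M]
    (m : M) (V : FGProj R) : V.obj →+ (bimodFunctor R M).obj V :=
  AddMonoidHom.mk' (fun v => bimodTmul M (V := V.obj) m v) fun _ _ => TensorProduct.tmul_add m _ _

end Bimodule

end Functors

/-! ### Elementary extensions and their splittings -/

section Extensions

variable {R : Type u} [CommRing R] {S : Type w} [Ring S]

/-- An elementary extension of `A` by `B` in the category `B(R, S)` of pointed functors: a complex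
`d : C₁ ⟶ C₀` of pointed functors with an exact sequence `0 → B → C₁ → C₀ → A → 0`. -/
structure ElemExt (A B : ProjFunctor R S) where
  C₁ : ProjFunctor R S
  C₀ : ProjFunctor R S
  pointed₁ : IsPointed C₁
  pointed₀ : IsPointed C₀
  b : B ⟶ C₁
  d : C₁ ⟶ C₀
  a : C₀ ⟶ A
  b_injective : ∀ V, Function.Injective (b.app V).hom
  exact₁ : ∀ V, Function.Exact (b.app V).hom (d.app V).hom
  exact₀ : ∀ V, Function.Exact (d.app V).hom (a.app V).hom
  a_surjective : ∀ V, Function.Surjective (a.app V).hom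

/-- The elementary extension obtained by applying restriction of scalars pointwise. -/
def ElemExt.restrict {S' : Type*} [Ring S'] (f : S' →+* S) {A B : ProjFunctor R S}
    (φ : ElemExt A B) : ElemExt (restr f A) (restr f B) where
  C₁ := restr f φ.C₁
  C₀ := restr f φ.C₀
  pointed₁ := φ.pointed₁
  pointed₀ := φ.pointed₀
  b := restrMap f φ.b
  d := restrMap f φ.d
  a := restrMap f φ.a
  b_injective := φ.b_injective
  exact₁ := φ.exact₁
  exact₀ := φ.exact₀
  a_surjective := φ.a_surjective

/-- A splitting of an elementary extension: an object `X` (usually denoted `C₀₁`) and maps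
`c₁ : C₁ ⟶ X`, `c₀ : X ⟶ C₀` such that `c₀ ∘ c₁ = d`, the resulting square with vertices
`C₁`, `X`, `Im d`, `C₀` is cartesian, and `c₀` is surjective. Equivalently, `X` carries a three-step
filtration `W₀ ⊆ W₁ ⊆ X` with `W₁ ≅ C₁`, `X / W₀ ≅ C₀`, `W₀ = B`, inducing `d : C₁ ⟶ C₀`. -/
structure ElemExt.Splitting {A B : ProjFunctor R S} (φ : ElemExt A B) where
  X : ProjFunctor R S
  pointed : IsPointed X
  c₁ : φ.C₁ ⟶ X
  c₀ : X ⟶ φ.C₀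
  comp : c₁ ≫ c₀ = φ.d
  cartesian : ∀ (V : FGProj R) (x : X.obj V),
    (c₀.app V).hom x ∈ Set.range (φ.d.app V).hom → ∃! c : φ.C₁.obj V, (c₁.app V).hom c = x
  c₀_surjective : ∀ V, Function.Surjective (c₀.app V).hom

end Extensions

/-! ### Multiplicative structures -/

section Multiplicative

variable {R : Type u} [CommRing R] {S : Type w} [Ring S]

/-- A multiplicative structure on a functor `F : R-proj ⥤ S-mod`, for a commutative ring `S`:
a unit `1 ∈ F(R)`, that is, an `S`-linear map `S → F(R)`, and functorial `S`-bilinear maps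
`F(V) × F(W) → F(V ⊗ W)`, that is, `F(V) ⊗_S F(W) → F(V ⊗ W)`, associative and unital. (The
commutativity of `S` is not needed to write this down, so it is not an instance argument.) -/
structure FunctorMul (F : ProjFunctor R S) where
  one : F.obj (𝟙_ (FGProj R))
  mul : ∀ V W : FGProj R, F.obj V →+ F.obj W →+ F.obj (V ⊗ W)
  smul_mul : ∀ V W (s : S) (x : F.obj V) (y : F.obj W), mul V W (s • x) y = s • mul V W x y
  mul_smul : ∀ V W (s : S) (x : F.obj V) (y : F.obj W), mul V W x (s • y) = s • mul V W x y
  map_mul : ∀ {V V' W W' : FGProj R} (f : V ⟶ V') (g : W ⟶ W') (x : F.obj V) (y : F.obj W),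
    (F.map (f ⊗ₘ g)).hom (mul V W x y) = mul V' W' ((F.map f).hom x) ((F.map g).hom y)
  assoc : ∀ (U V W : FGProj R) (x : F.obj U) (y : F.obj V) (z : F.obj W),
    (F.map (α_ U V W).hom).hom (mul (U ⊗ V) W (mul U V x y) z) = mul U (V ⊗ W) x (mul V W y z)
  one_mul : ∀ V (x : F.obj V), (F.map (λ_ V).hom).hom (mul (𝟙_ _) V one x) = x
  mul_one : ∀ V (x : F.obj V), (F.map (ρ_ V).hom).hom (mul V (𝟙_ _) x one) = x

/-- A multiplicative structure (a DG algebra structure) on a complex `d : F₁ ⟶ F₀` of functors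
concentrated in homological degrees `1` and `0`. Products of two elements of degree `1` lie in
degree `2`, hence vanish; the Leibniz rule for such a product is `leibniz₁₁`. -/
structure ComplexMul {F₁ F₀ : ProjFunctor R S} (d : F₁ ⟶ F₀) extends FunctorMul F₀ where
  mul₀₁ : ∀ V W : FGProj R, F₀.obj V →+ F₁.obj W →+ F₁.obj (V ⊗ W)
  mul₁₀ : ∀ V W : FGProj R, F₁.obj V →+ F₀.obj W →+ F₁.obj (V ⊗ W)
  smul_mul₀₁ : ∀ V W (s : S) (x : F₀.obj V) (c : F₁.obj W),
    mul₀₁ V W (s • x) c = s • mul₀₁ V W x c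
  mul₀₁_smul : ∀ V W (s : S) (x : F₀.obj V) (c : F₁.obj W),
    mul₀₁ V W x (s • c) = s • mul₀₁ V W x c
  smul_mul₁₀ : ∀ V W (s : S) (c : F₁.obj V) (x : F₀.obj W),
    mul₁₀ V W (s • c) x = s • mul₁₀ V W c x
  mul₁₀_smul : ∀ V W (s : S) (c : F₁.obj V) (x : F₀.obj W),
    mul₁₀ V W c (s • x) = s • mul₁₀ V W c x
  map_mul₀₁ : ∀ {V V' W W' : FGProj R} (f : V ⟶ V') (g : W ⟶ W') (x : F₀.obj V) (c : F₁.obj W),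
    (F₁.map (f ⊗ₘ g)).hom (mul₀₁ V W x c) = mul₀₁ V' W' ((F₀.map f).hom x) ((F₁.map g).hom c)
  map_mul₁₀ : ∀ {V V' W W' : FGProj R} (f : V ⟶ V') (g : W ⟶ W') (c : F₁.obj V) (x : F₀.obj W),
    (F₁.map (f ⊗ₘ g)).hom (mul₁₀ V W c x) = mul₁₀ V' W' ((F₁.map f).hom c) ((F₀.map g).hom x)
  assoc₀₀₁ : ∀ (U V W : FGProj R) (x : F₀.obj U) (y : F₀.obj V) (c : F₁.obj W),
    (F₁.map (α_ U V W).hom).hom (mul₀₁ (U ⊗ V) W (mul U V x y) c) =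
      mul₀₁ U (V ⊗ W) x (mul₀₁ V W y c)
  assoc₀₁₀ : ∀ (U V W : FGProj R) (x : F₀.obj U) (c : F₁.obj V) (y : F₀.obj W),
    (F₁.map (α_ U V W).hom).hom (mul₁₀ (U ⊗ V) W (mul₀₁ U V x c) y) =
      mul₀₁ U (V ⊗ W) x (mul₁₀ V W c y)
  assoc₁₀₀ : ∀ (U V W : FGProj R) (c : F₁.obj U) (x : F₀.obj V) (y : F₀.obj W),
    (F₁.map (α_ U V W).hom).hom (mul₁₀ (U ⊗ V) W (mul₁₀ U V c x) y) =
      mul₁₀ U (V ⊗ W) c (mul V W x y)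
  one_mul₀₁ : ∀ V (c : F₁.obj V), (F₁.map (λ_ V).hom).hom (mul₀₁ (𝟙_ _) V one c) = c
  mul₁₀_one : ∀ V (c : F₁.obj V), (F₁.map (ρ_ V).hom).hom (mul₁₀ V (𝟙_ _) c one) = c
  leibniz₀₁ : ∀ V W (x : F₀.obj V) (c : F₁.obj W),
    (d.app (V ⊗ W)).hom (mul₀₁ V W x c) = mul V W x ((d.app W).hom c)
  leibniz₁₀ : ∀ V W (c : F₁.obj V) (x : F₀.obj W),
    (d.app (V ⊗ W)).hom (mul₁₀ V W c x) = mul V W ((d.app V).hom c) x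
  leibniz₁₁ : ∀ V W (c : F₁.obj V) (c' : F₁.obj W),
    mul₀₁ V W ((d.app V).hom c) c' - mul₁₀ V W c ((d.app W).hom c') = 0

/-- A multiplicative structure on an elementary extension of an algebra `A`: a DG algebra structure
on the complex `d : C₁ ⟶ C₀` for which the augmentation `a` is a map of DG algebras (in positive
degrees, this is no condition). -/
structure ElemExt.Mul {A B : ProjFunctor R S} (φ : ElemExt A B) (α : FunctorMul A)
    extends ComplexMul φ.d where
  a_one : (φ.a.app (𝟙_ _)).hom one = α.one
  a_mul : ∀ V W (x : φ.C₀.obj V) (y : φ.C₀.obj W),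
    (φ.a.app (V ⊗ W)).hom (mul V W x y) = α.mul V W ((φ.a.app V).hom x) ((φ.a.app W).hom y)

/-- A multiplicative structure on a splitting `⟨X, c₀, c₁⟩` of a multiplicative elementary
extension: a DG algebra structure on the complex `c₁ : C₁ ⟶ X` for which the map of complexes with
components `id : C₁ ⟶ C₁` and `c₀ : X ⟶ C₀` is a map of DG algebras. -/
structure ElemExt.Splitting.Mul {A B : ProjFunctor R S} {φ : ElemExt A B} {α : FunctorMul A}
    (X : φ.Splitting) (μ : φ.Mul α) extends ComplexMul X.c₁ where
  c₀_one : (X.c₀.app (𝟙_ _)).hom one = μ.one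
  c₀_mul : ∀ V W (x : X.X.obj V) (y : X.X.obj W),
    (X.c₀.app (V ⊗ W)).hom (mul V W x y) = μ.mul V W ((X.c₀.app V).hom x) ((X.c₀.app W).hom y)
  id_mul₀₁ : ∀ V W (x : X.X.obj V) (c : φ.C₁.obj W),
    mul₀₁ V W x c = μ.mul₀₁ V W ((X.c₀.app V).hom x) c
  id_mul₁₀ : ∀ V W (c : φ.C₁.obj V) (x : X.X.obj W),
    mul₁₀ V W c x = μ.mul₁₀ V W c ((X.c₀.app W).hom x)

variable {S' : Type*} [Ring S']

/-- Restriction of scalars of a multiplicative structure: the products are the same. -/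
def FunctorMul.restrict (f : S' →+* S) {F : ProjFunctor R S} (μ : FunctorMul F) :
    FunctorMul (restr f F) where
  one := μ.one
  mul := μ.mul
  smul_mul := fun V W s x y => μ.smul_mul V W (f s) x y
  mul_smul := fun V W s x y => μ.mul_smul V W (f s) x y
  map_mul := μ.map_mul
  assoc := μ.assoc
  one_mul := μ.one_mul
  mul_one := μ.mul_one

/-- Restriction of scalars of a multiplicative structure: the products are the same. -/
def ComplexMul.restrict (f : S' →+* S) {F₁ F₀ : ProjFunctor R S} {d : F₁ ⟶ F₀}
    (μ : ComplexMul d) : ComplexMul (restrMap f d) where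
  toFunctorMul := μ.toFunctorMul.restrict f
  mul₀₁ := μ.mul₀₁
  mul₁₀ := μ.mul₁₀
  smul_mul₀₁ := fun V W s x c => μ.smul_mul₀₁ V W (f s) x c
  mul₀₁_smul := fun V W s x c => μ.mul₀₁_smul V W (f s) x c
  smul_mul₁₀ := fun V W s c x => μ.smul_mul₁₀ V W (f s) c x
  mul₁₀_smul := fun V W s c x => μ.mul₁₀_smul V W (f s) c x
  map_mul₀₁ := μ.map_mul₀₁
  map_mul₁₀ := μ.map_mul₁₀
  assoc₀₀₁ := μ.assoc₀₀₁
  assoc₀₁₀ := μ.assoc₀₁₀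
  assoc₁₀₀ := μ.assoc₁₀₀
  one_mul₀₁ := μ.one_mul₀₁
  mul₁₀_one := μ.mul₁₀_one
  leibniz₀₁ := μ.leibniz₀₁
  leibniz₁₀ := μ.leibniz₁₀
  leibniz₁₁ := μ.leibniz₁₁

/-- Restriction of scalars of a multiplicative elementary extension. -/
def ElemExt.Mul.restrict (f : S' →+* S) {A B : ProjFunctor R S} {φ : ElemExt A B}
    {α : FunctorMul A} (μ : φ.Mul α) : (φ.restrict f).Mul (α.restrict f) where
  toComplexMul := μ.toComplexMul.restrict f
  a_one := μ.a_one
  a_mul := μ.a_mul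

variable (R) in
/-- The multiplicative structure of the tautological functor `I`: `(v, w) ↦ v ⊗ w`, with the unit
`1 ∈ R`. -/
def tautMul : FunctorMul (tautFunctor R) where
  one := (1 : R)
  mul := fun V W => AddMonoidHom.mk' (fun x => (TensorProduct.mk R V.obj W.obj x).toAddMonoidHom)
    (fun x x' => by ext y; exact TensorProduct.add_tmul x x' y)
  smul_mul := fun V W s x y => (TensorProduct.smul_tmul' s x y).symm
  mul_smul := fun V W s x y => TensorProduct.tmul_smul s x y
  map_mul := fun f g x y => rfl
  assoc := fun U V W x y z => rfl
  one_mul := fun V x => one_smul R (x : V.obj)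
  mul_one := fun V x => one_smul R (x : V.obj)

end Multiplicative

/-! ### Square-zero extensions -/

section SquareZero

variable {R : Type u} [CommRing R] {M : Type u} [AddCommGroup M] [Module R M] [Module Rᵐᵒᵖ M]

/-- The ring `R'` with the maps `i : M → R'` and `q : R' → R` is a square-zero extension of `R`
by the `R`-bimodule `M`. -/
structure IsSquareZeroExtension {R' : Type*} [Ring R'] (i : M →+ R') (q : R' →+* R) : Prop where
  injective : Function.Injective i
  exact : Function.Exact i q
  surjective : Function.Surjective q
  right : ∀ (m : M) (r' : R'), i m * r' = i (op (q r') • m)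
  left : ∀ (m : M) (r' : R'), r' * i m = i (q r' • m)
  square_zero : ∀ m m' : M, i m * i m' = 0

variable [SMulCommClass R Rᵐᵒᵖ M]

/-- An elementary extension of a commutative ring `R` by an `R`-bimodule `M` is an elementary
extension of `I` by `I(M)` in `B(R) = B(R, R)`. -/
abbrev RingElemExt (R : Type u) [CommRing R] (M : Type u) [AddCommGroup M] [Module R M]
    [Module Rᵐᵒᵖ M] [SMulCommClass R Rᵐᵒᵖ M] :=
  ElemExt (tautFunctor R) (bimodFunctor R M)

namespace RingElemExt

/-- The elementary extension `e_* φ` in `B(R, ℤ)`, where `e : ℤ → R` is the tautological map. -/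
abbrev eStar (φ : RingElemExt R M) := ElemExt.restrict (Int.castRingHom R) φ

variable {φ : RingElemExt R M} (X : (eStar φ).Splitting)

/-- The map `c₁ : C₁(V) → X(V)` of abelian groups. -/
def incl (V : FGProj R) : φ.C₁.obj V →+ X.X.obj V := (X.c₁.app V).hom.toAddMonoidHom

/-- The map `c₀ : X(V) → C₀(V)` of abelian groups. -/
def proj (V : FGProj R) : X.X.obj V →+ φ.C₀.obj V := (X.c₀.app V).hom.toAddMonoidHom

/-- The action of an endomorphism of `X` on `X(V)`; multiplication in `End X.X` is composition of
maps, `f * g = f ∘ g`. -/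
def act (f : End X.X) (V : FGProj R) : X.X.obj V →+ X.X.obj V :=
  (NatTrans.app (F := X.X) (G := X.X) f V).hom.toAddMonoidHom

theorem act_one (V : FGProj R) (x : X.X.obj V) : act X 1 V x = x := rfl

theorem act_mul (f g : End X.X) (V : FGProj R) (x : X.X.obj V) :
    act X (f * g) V x = act X f V (act X g V x) := rfl

theorem act_add (f g : End X.X) (V : FGProj R) (x : X.X.obj V) :
    act X (f + g) V x = act X f V x + act X g V x := rfl

theorem act_zero (V : FGProj R) (x : X.X.obj V) : act X 0 V x = 0 := rfl

theorem act_neg (f : End X.X) (V : FGProj R) (x : X.X.obj V) :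
    act X (-f) V x = -act X f V x := rfl

theorem act_ext {f g : End X.X} (h : ∀ V x, act X f V x = act X g V x) : f = g :=
  NatTrans.ext (funext fun V => ModuleCat.hom_ext (LinearMap.ext fun x => h V x))

/-- The endomorphism `f` of the splitting `X` of `e_* φ` is compatible, via `c₁` and `c₀`, with
multiplication by `r` on `C₁` and `C₀`. -/
def RegularOver (f : End X.X) (r : R) : Prop :=
  (∀ (V : FGProj R) (c : φ.C₁.obj V), act X f V (incl X V c) = incl X V (r • c)) ∧
  (∀ (V : FGProj R) (x : X.X.obj V), proj X V (act X f V x) = r • proj X V x)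

variable {X}

theorem RegularOver.one : RegularOver X 1 1 :=
  ⟨fun V c => by rw [one_smul, act_one], fun V x => by rw [one_smul, act_one]⟩

theorem RegularOver.zero : RegularOver X 0 0 :=
  ⟨fun V c => by rw [zero_smul, act_zero, map_zero],
    fun V x => by rw [zero_smul, act_zero, map_zero]⟩

theorem RegularOver.mul {f g : End X.X} {r s : R} (h : RegularOver X f r)
    (k : RegularOver X g s) : RegularOver X (f * g) (r * s) :=
  ⟨fun V c => by rw [act_mul, k.1, h.1, mul_smul], fun V x => by rw [act_mul, h.2, k.2, mul_smul]⟩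

theorem RegularOver.add {f g : End X.X} {r s : R} (h : RegularOver X f r)
    (k : RegularOver X g s) : RegularOver X (f + g) (r + s) :=
  ⟨fun V c => by rw [act_add, k.1, h.1, add_smul, map_add],
    fun V x => by rw [act_add, map_add, h.2, k.2, add_smul]⟩

theorem RegularOver.neg {f : End X.X} {r : R} (h : RegularOver X f r) : RegularOver X (-f) (-r) :=
  ⟨fun V c => by rw [act_neg, h.1, neg_smul, map_neg],
    fun V x => by rw [act_neg, map_neg, h.2, neg_smul]⟩

theorem RegularOver.unique {f : End X.X} {r s : R} (h : RegularOver X f r)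
    (k : RegularOver X f s) : r = s := by
  obtain ⟨y, hy⟩ := φ.a_surjective (𝟙_ _) (1 : R)
  obtain ⟨x, hx⟩ := X.c₀_surjective (𝟙_ _) y
  have hx' : proj X (𝟙_ _) x = y := hx
  have e := (h.2 _ x).symm.trans (k.2 _ x)
  rw [hx'] at e
  have e' := congrArg (φ.a.app (𝟙_ _)).hom e
  rw [map_smul, map_smul, hy] at e'
  simpa using (show r * 1 = s * 1 from e')

variable (X)

/-- The ring `R'` of regular endomorphisms of the splitting `X` of `e_* φ`. -/
def regularRing : Subring (End X.X) where
  carrier := {f | ∃ r : R, RegularOver X f r}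
  mul_mem' := fun ⟨_, h⟩ ⟨_, k⟩ => ⟨_, h.mul k⟩
  one_mem' := ⟨1, .one⟩
  add_mem' := fun ⟨_, h⟩ ⟨_, k⟩ => ⟨_, h.add k⟩
  zero_mem' := ⟨0, .zero⟩
  neg_mem' := fun ⟨_, h⟩ => ⟨_, h.neg⟩

/-- The map `q : R' → R` sending a regular endomorphism to the unique element `r ∈ R` over which it
is regular. -/
def regularProj : regularRing X →+* R where
  toFun f := f.2.choose
  map_one' := (1 : regularRing X).2.choose_spec.unique .one
  map_mul' f g := (f * g).2.choose_spec.unique (f.2.choose_spec.mul g.2.choose_spec)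
  map_zero' := (0 : regularRing X).2.choose_spec.unique .zero
  map_add' f g := (f + g).2.choose_spec.unique (f.2.choose_spec.add g.2.choose_spec)

theorem regularProj_spec (f : regularRing X) : RegularOver X f.1 (regularProj X f) :=
  f.2.choose_spec

/-- A map of abelian groups, as a morphism of `ℤ`-modules. -/
def intHom {N N' : ModuleCat.{u} ℤ} (f : N →+ N') : N ⟶ N' :=
  ModuleCat.ofHom
    { toFun := f
      map_add' := map_add f
      map_smul' := fun n x => by simpa using map_intCast_smul f ℤ ℤ n x }

/-- The natural transformation `V → M ⊗_R V`, `v ↦ m ⊗ v`, of functors to abelian groups. -/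
def tmulLeft (m : M) : restr (Int.castRingHom R) (tautFunctor R) ⟶
    restr (Int.castRingHom R) (bimodFunctor R M) where
  app V := intHom (N := (restr (Int.castRingHom R) (tautFunctor R)).obj V)
    (N' := (restr (Int.castRingHom R) (bimodFunctor R M)).obj V) (bimodMk m V)
  naturality _ _ _ := rfl

/-- The endomorphism of `X` given by the composition of
`X → C₀ → I`, of `v ↦ m ⊗ v`, and of `I(M) → C₁ → X`. -/
def kernelEnd (m : M) : End X.X :=
  X.c₀ ≫ (eStar φ).a ≫ tmulLeft m ≫ (eStar φ).b ≫ X.c₁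

theorem act_kernelEnd (m : M) (V : FGProj R) (x : X.X.obj V) :
    act X (kernelEnd X m) V x =
      incl X V ((φ.b.app V).hom (bimodMk m V ((φ.a.app V).hom (proj X V x)))) := rfl

theorem proj_incl (V : FGProj R) (c : φ.C₁.obj V) :
    proj X V (incl X V c) = (φ.d.app V).hom c :=
  congrArg (fun t : φ.eStar.C₁ ⟶ φ.eStar.C₀ => (t.app V).hom.toAddMonoidHom c) X.comp

theorem kernelEnd_regular (m : M) : RegularOver X (kernelEnd X m) 0 := by
  refine ⟨fun V c => ?_, fun V x => ?_⟩
  · have h : (φ.a.app V).hom ((φ.d.app V).hom c) = (0 : V.obj) := (φ.exact₀ V).apply_apply_eq_zero c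
    rw [act_kernelEnd, proj_incl, zero_smul, map_zero, h, map_zero, map_zero, map_zero]
  · rw [act_kernelEnd, proj_incl, (φ.exact₁ V).apply_apply_eq_zero, zero_smul]

theorem bimodMk_add (m m' : M) (V : FGProj R) (v : V.obj) :
    bimodMk (m + m') V v = bimodMk m V v + bimodMk m' V v :=
  TensorProduct.add_tmul m m' _

/-- The map `i : M → R'`. -/
def regularIncl : M →+ regularRing X :=
  AddMonoidHom.mk' (fun m => ⟨kernelEnd X m, 0, kernelEnd_regular X m⟩) fun m m' => by
    refine Subtype.ext (act_ext X fun V x => ?_)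
    refine Eq.trans ?_ (act_add X (kernelEnd X m) (kernelEnd X m') V x).symm
    rw [act_kernelEnd, act_kernelEnd, act_kernelEnd, bimodMk_add, map_add, map_add]

/-- The tautological action of the ring `R'` of regular endomorphisms on `X(V)`. -/
abbrev regularModule (V : FGProj R) : Module (regularRing X) (X.X.obj V) where
  smul f x := act X f.1 V x
  one_smul _ := rfl
  mul_smul _ _ _ := rfl
  smul_zero f := map_zero (act X f.1 V)
  smul_add f := map_add (act X f.1 V)
  add_smul _ _ _ := rfl
  zero_smul _ := rfl

/-- The abelian group `X(V)` with the tautological action of `R'`. -/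
abbrev regularObj (V : FGProj R) : ModuleCat.{u} (regularRing X) :=
  letI := regularModule X V
  ModuleCat.of (regularRing X) (X.X.obj V)

theorem regularObj_smul (V : FGProj R) (f : regularRing X) (x : regularObj X V) :
    f • x = act X f.1 V x := rfl

/-- The functor `X`, considered as a functor to `R'`-modules by means of the tautological action. -/
def regularFunctor : ProjFunctor R (regularRing X) where
  obj V := regularObj X V
  map {V W} g := ModuleCat.ofHom (X := regularObj X V) (Y := regularObj X W)
    { toFun := (X.X.map g).hom
      map_add' := map_add (X.X.map g).hom
      map_smul' := fun f x =>
        (LinearMap.congr_fun (congrArg ModuleCat.Hom.hom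
          (NatTrans.naturality (F := X.X) (G := X.X) f.1 g)) x).symm }
  map_id V := ModuleCat.hom_ext (LinearMap.ext fun x =>
    LinearMap.congr_fun (congrArg ModuleCat.Hom.hom (X.X.map_id V)) x)
  map_comp f g := ModuleCat.hom_ext (LinearMap.ext fun x =>
    LinearMap.congr_fun (congrArg ModuleCat.Hom.hom (X.X.map_comp f g)) x)

/-- The splitting `X` of `e_* φ`, with the tautological action of `R'` on `X`, considered as a
splitting of the elementary extension `q_* φ` in `B(R, R')`. -/
def regularSplitting : (ElemExt.restrict (regularProj X) φ).Splitting where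
  X := regularFunctor X
  pointed := X.pointed
  c₁ :=
    { app := fun V =>
        ModuleCat.ofHom (X := (restr (regularProj X) φ.C₁).obj V) (Y := regularObj X V)
          { toFun := incl X V
            map_add' := map_add (incl X V)
            map_smul' := fun f c => ((regularProj_spec X f).1 V c).symm }
      naturality := fun _ _ g => ModuleCat.hom_ext (LinearMap.ext fun c =>
        LinearMap.congr_fun (congrArg ModuleCat.Hom.hom (X.c₁.naturality g)) c) }
  c₀ :=
    { app := fun V =>
        ModuleCat.ofHom (X := regularObj X V) (Y := (restr (regularProj X) φ.C₀).obj V)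
          { toFun := proj X V
            map_add' := map_add (proj X V)
            map_smul' := fun f x => (regularProj_spec X f).2 V x }
      naturality := fun _ _ g => ModuleCat.hom_ext (LinearMap.ext fun x =>
        LinearMap.congr_fun (congrArg ModuleCat.Hom.hom (X.c₀.naturality g)) x) }
  comp := NatTrans.ext (funext fun V => ModuleCat.hom_ext (LinearMap.ext fun c => proj_incl X V c))
  cartesian := X.cartesian
  c₀_surjective := X.c₀_surjective

end RingElemExt

end SquareZero

end

/-!
Choose a lift `o ∈ C₀(R)` of `1 ∈ R`. By the Yoneda lemma it gives a natural family of maps of sets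
`v ↦ [v]` from `V` to `C₀(V)`, and the additivity defect `[v] + [w] - [v + w]` lifts naturally to
`C₁(V)`. A natural family of two or three variables with values in an additive functor vanishes if
it vanishes on the coordinate axes; since `I(M) = Ker d` is additive, the normalised lift of the
defect is therefore a symmetric cocycle, and it twists the sum of `V` and `C₁(V)` into a splitting.

Conversely, let `X` be any splitting and `u ∈ X(R)` a lift of `1 ∈ R`. Every element of `X(V)` is
uniquely of the form `[v] + c₁(c)`, where `[v]` now comes from `u`, so that `X` is generated by `C₁`
and `u` subject to relations prescribing the defect of `u`. An endomorphism over `r ∈ R` is thus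
given by a lift of `r · c₀(u)`, any lift satisfies the relations by the vanishing principle above,
and the lifts of zero are the elements of `I(M)(R) = M`.

Let now `u` lift the unit of `C₀`. A product on `X` with unit `u` must satisfy
`x · [w] = (id ⊗ w)_* x` and `x · c₁(c) = c₁(c₀(x) · c)`, which determines it and gives its
existence. These formulas also show that regular endomorphisms are linear in both arguments of any
product, whence `f(g(u · u)) = f(u) · g(u) = g(f(u · u))` and the commutativity of `R'`.
-/

noncomputable section

namespace FGProj

variable {R : Type u} [CommRing R] {V W : FGProj R}

theorem hom_ext {f g : V ⟶ W} (h : ∀ v : V.obj, f.hom.hom v = g.hom.hom v) : f = g :=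
  ObjectProperty.hom_ext _ (ModuleCat.hom_ext (LinearMap.ext h))

/-- A linear map, as a morphism of the full subcategory `R-proj`. -/
abbrev ofLinear (f : V.obj →ₗ[R] W.obj) : V ⟶ W :=
  ObjectProperty.homMk (ModuleCat.ofHom f)

/-- The map `R → V` with `1 ↦ v`. -/
def point (v : V.obj) : 𝟙_ (FGProj R) ⟶ V :=
  ofLinear (V := 𝟙_ (FGProj R)) (LinearMap.toSpanSingleton R V.obj v)

theorem point_comp (v : V.obj) (f : V ⟶ W) : point v ≫ f = point (f.hom.hom v) :=
  hom_ext fun r : R => map_smul f.hom.hom r v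

theorem point_zero : point (0 : V.obj) = 0 :=
  hom_ext fun r : R => smul_zero r

theorem point_one : point (V := 𝟙_ (FGProj R)) (1 : R) = 𝟙 _ :=
  hom_ext fun r : R => mul_one r

variable (R) in
/-- The free module `R^n`, as an object of `R-proj`. -/
def free (n : ℕ) : FGProj R :=
  ⟨ModuleCat.of R (Fin n → R), inferInstanceAs (Module.Finite R (Fin n → R)),
    inferInstanceAs (Module.Projective R (Fin n → R))⟩

variable {n : ℕ}

variable (R) in
/-- The standard basis of `R^n`. -/
def stdBasis (j : Fin n) : (free R n).obj := (Pi.single j 1 : Fin n → R)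

/-- The map `R^n → V` sending the standard basis to the tuple `v`. -/
def tuple (v : Fin n → V.obj) : free R n ⟶ V :=
  ofLinear (V := free R n) (Fintype.linearCombination R v)

theorem tuple_stdBasis (v : Fin n → V.obj) (j : Fin n) :
    (tuple v).hom.hom (stdBasis R j) = v j :=
  (Fintype.linearCombination_apply_single R v j 1).trans (one_smul R _)

theorem tuple_comp (v : Fin n → V.obj) (f : V ⟶ W) :
    tuple v ≫ f = tuple fun j => f.hom.hom (v j) := by
  refine hom_ext fun r : Fin n → R => ?_
  change f.hom.hom (Fintype.linearCombination R v r) = Fintype.linearCombination R _ r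
  simp only [Fintype.linearCombination_apply, map_sum, map_smul]

theorem tuple_zero : tuple (fun _ : Fin n => (0 : V.obj)) = 0 :=
  hom_ext fun r : Fin n → R => (Fintype.linearCombination_apply R _ r).trans <|
    Finset.sum_eq_zero fun j _ => smul_zero (r j)

variable (R) in
/-- The idempotent of `R^n` onto its `j`-th coordinate axis. -/
def axisProj (j : Fin n) : free R n ⟶ free R n :=
  ofLinear (V := free R n) (W := free R n)
    (LinearMap.single R (fun _ => R) j ∘ₗ LinearMap.proj j)

theorem sum_axisProj : ∑ j, axisProj R j = 𝟙 (free R n) := by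
  refine (fgProj R).ι.map_injective ?_
  rw [Functor.map_sum, (fgProj R).ι.map_id]
  refine ModuleCat.hom_ext (LinearMap.ext fun r => ?_)
  rw [ModuleCat.hom_sum, LinearMap.sum_apply]
  exact LinearMap.sum_single_apply (fun _ : Fin n => R) r

theorem axisProj_stdBasis (i j : Fin n) :
    (axisProj R j).hom.hom (stdBasis R i) =
      (Pi.single j (stdBasis R j) : Fin n → (free R n).obj) i := by
  change (Pi.single j ((Pi.single i 1 : Fin n → R) j) : Fin n → R) = _
  rcases eq_or_ne i j with rfl | h
  · rw [Pi.single_eq_same]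
    exact (Pi.single_eq_same (M := fun _ => (free R n).obj) i _).symm
  · rw [Pi.single_eq_of_ne h, Pi.single_eq_of_ne (Ne.symm h), Pi.single_zero]
    rfl

/-- The element `v ⊗ w` of `V ⊗ W`. -/
abbrev tmul (v : V.obj) (w : W.obj) : (V ⊗ W).obj :=
  TensorProduct.tmul R (M := V.obj) (N := W.obj) v w

variable (V) in
/-- The map `v ↦ v ⊗ w`. -/
def tensorRight (w : W.obj) : V ⟶ V ⊗ W :=
  ofLinear (W := V ⊗ W) ((TensorProduct.mk R V.obj W.obj).flip w)

variable (W) in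
/-- The map `w ↦ v ⊗ w`. -/
def tensorLeft (v : V.obj) : W ⟶ V ⊗ W :=
  ofLinear (W := V ⊗ W) (TensorProduct.mk R V.obj W.obj v)

theorem tensorRight_zero : tensorRight V (0 : W.obj) = 0 :=
  hom_ext fun v => TensorProduct.tmul_zero _ (v : V.obj)

theorem tensorLeft_zero : tensorLeft W (0 : V.obj) = 0 :=
  hom_ext fun w => TensorProduct.zero_tmul _ (w : W.obj)

variable {U V' W' : FGProj R}

theorem tensor_hom_ext {f g : V ⊗ W ⟶ U}
    (h : ∀ (v : V.obj) (w : W.obj), f.hom.hom (tmul v w) = g.hom.hom (tmul v w)) : f = g :=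
  hom_ext (LinearMap.congr_fun (TensorProduct.ext' (M := V.obj) (N := W.obj) h))

theorem rightUnitor_comp_tensorRight (w : W.obj) :
    (ρ_ V).hom ≫ tensorRight V w = 𝟙 V ⊗ₘ point w :=
  tensor_hom_ext fun v (r : R) => TensorProduct.smul_tmul r (v : V.obj) (w : W.obj)

theorem leftUnitor_comp_tensorLeft (v : V.obj) :
    (λ_ W).hom ≫ tensorLeft W v = point v ⊗ₘ 𝟙 W :=
  tensor_hom_ext fun (r : R) w => (TensorProduct.smul_tmul r (v : V.obj) (w : W.obj)).symm

theorem tensorRight_comp_tensorHom (f : V ⟶ V') (g : W ⟶ W') (w : W.obj) :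
    tensorRight V w ≫ (f ⊗ₘ g) = f ≫ tensorRight V' (g.hom.hom w) :=
  rfl

theorem tensorRight_comp_associator (w : W.obj) :
    tensorRight (U ⊗ V) w ≫ (α_ U V W).hom = 𝟙 U ⊗ₘ tensorRight V w :=
  tensor_hom_ext fun _ _ => rfl

theorem tensorRight_one_comp_rightUnitor :
    tensorRight V (W := 𝟙_ (FGProj R)) (1 : R) ≫ (ρ_ V).hom = 𝟙 V :=
  hom_ext fun v => one_smul R (v : V.obj)

theorem tensorLeft_one_comp_leftUnitor :
    tensorLeft V (V := 𝟙_ (FGProj R)) (1 : R) ≫ (λ_ V).hom = 𝟙 V :=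
  hom_ext fun v => one_smul R (v : V.obj)

end FGProj

theorem IsPointed.map_zero {R : Type u} [CommRing R] {S : Type w} [Ring S]
    {F : ProjFunctor R S} (hF : IsPointed F) (V W : FGProj R) : F.map (0 : V ⟶ W) = 0 := by
  have : Subsingleton (F.obj (FGProj.free R 0)) :=
    hF _ (inferInstanceAs (Subsingleton (Fin 0 → R)))
  have h : (0 : V ⟶ W) = (0 : V ⟶ FGProj.free R 0) ≫ 0 := by simp
  rw [h, F.map_comp, (ModuleCat.isZero_of_subsingleton _).eq_of_tgt (F.map _) 0, Limits.zero_comp]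

namespace ProjFunctor

variable {R : Type u} [CommRing R] {S : Type w} [Ring S] {F G B : ProjFunctor R S}

theorem map_map_apply {U V W : FGProj R} (f : U ⟶ V) (g : V ⟶ W) (x : F.obj U) :
    (F.map g).hom ((F.map f).hom x) = (F.map (f ≫ g)).hom x := by
  rw [F.map_comp]; rfl

theorem map_id_apply {V : FGProj R} (x : F.obj V) : (F.map (𝟙 V)).hom x = x := by
  rw [F.map_id]; rfl

theorem naturality_apply (t : F ⟶ G) {V W : FGProj R} (f : V ⟶ W) (x : F.obj V) :
    (t.app W).hom ((F.map f).hom x) = (G.map f).hom ((t.app V).hom x) :=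
  NatTrans.naturality_apply t f x

variable (F) in
/-- By the Yoneda lemma, an element `t ∈ F(R)` amounts to a natural transformation of sets
`V → F(V)`. This is its value at `v ∈ V`, the image of `t` under `R → V`, `1 ↦ v`. -/
def yonedaEval (t : F.obj (𝟙_ (FGProj R))) {V : FGProj R} (v : V.obj) : F.obj V :=
  (F.map (FGProj.point v)).hom t

theorem map_yonedaEval (t : F.obj (𝟙_ (FGProj R))) {V W : FGProj R} (f : V ⟶ W) (v : V.obj) :
    (F.map f).hom (F.yonedaEval t v) = F.yonedaEval t (f.hom.hom v) := by
  rw [yonedaEval, yonedaEval, map_map_apply, FGProj.point_comp]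

theorem app_yonedaEval (s : F ⟶ G) (t : F.obj (𝟙_ (FGProj R))) {V : FGProj R} (v : V.obj) :
    (s.app V).hom (F.yonedaEval t v) = G.yonedaEval ((s.app _).hom t) v :=
  naturality_apply s _ t

theorem yonedaEval_smul (s : S) (t : F.obj (𝟙_ (FGProj R))) {V : FGProj R} (v : V.obj) :
    F.yonedaEval (s • t) v = s • F.yonedaEval t v :=
  map_smul _ s t

theorem yonedaEval_zero (hF : IsPointed F) (t : F.obj (𝟙_ (FGProj R))) (V : FGProj R) :
    F.yonedaEval t (0 : V.obj) = 0 := by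
  rw [yonedaEval, FGProj.point_zero, hF.map_zero]; rfl

theorem yonedaEval_one (t : F.obj (𝟙_ (FGProj R))) :
    F.yonedaEval t (V := 𝟙_ (FGProj R)) (1 : R) = t := by
  rw [yonedaEval, FGProj.point_one, map_id_apply]

/-- A natural family of maps of sets `V^n → G(V)` is determined by its value at the standard basis
of `R^n`; if that value comes from an additive functor, it is the sum of its restrictions to the
coordinate axes. -/
theorem eq_zero_of_forall_single_eq_zero [B.Additive] (b : B ⟶ G) {n : ℕ}
    (T : ∀ V : FGProj R, (Fin n → V.obj) → G.obj V)
    (natural : ∀ {V W : FGProj R} (f : V ⟶ W) v,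
      (G.map f).hom (T V v) = T W fun j => f.hom.hom (v j))
    (mem_range : ∀ V v, T V v ∈ Set.range (b.app V).hom)
    (single : ∀ (V : FGProj R) (j : Fin n) (v : V.obj), T V (Pi.single j v) = 0)
    (V : FGProj R) (v : Fin n → V.obj) : T V v = 0 := by
  have basis_eq_zero : T (FGProj.free R n) (FGProj.stdBasis R) = 0 := by
    obtain ⟨x, hx⟩ := mem_range _ (FGProj.stdBasis R)
    have hsum : x = ∑ j, (B.map (FGProj.axisProj R j)).hom x := by
      rw [← LinearMap.sum_apply, ← ModuleCat.hom_sum, ← Functor.map_sum, FGProj.sum_axisProj,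
        map_id_apply]
    rw [← hx, hsum, map_sum]
    refine Finset.sum_eq_zero fun j _ => ?_
    rw [naturality_apply, hx, natural]
    simpa only [FGProj.axisProj_stdBasis] using single _ j (FGProj.stdBasis R j)
  have h := natural (FGProj.tuple v) (FGProj.stdBasis R)
  simp only [basis_eq_zero, map_zero, FGProj.tuple_stdBasis] at h
  exact h.symm

theorem eq_zero_of_axes₂ [B.Additive] (b : B ⟶ G)
    (T : ∀ V : FGProj R, V.obj → V.obj → G.obj V)
    (natural : ∀ {V W : FGProj R} (f : V ⟶ W) v v',
      (G.map f).hom (T V v v') = T W (f.hom.hom v) (f.hom.hom v'))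
    (mem_range : ∀ V v v', T V v v' ∈ Set.range (b.app V).hom)
    (axis₀ : ∀ V v, T V v 0 = 0) (axis₁ : ∀ V v, T V 0 v = 0)
    (V : FGProj R) (v v' : V.obj) : T V v v' = 0 := by
  refine eq_zero_of_forall_single_eq_zero b (n := 2) (fun V v => T V (v 0) (v 1))
    (fun f v => natural f _ _) (fun V v => mem_range V _ _) (fun V j v => ?_) V ![v, v']
  fin_cases j
  · exact axis₀ V v
  · exact axis₁ V v

theorem eq_zero_of_axes₃ [B.Additive] (b : B ⟶ G)
    (T : ∀ V : FGProj R, V.obj → V.obj → V.obj → G.obj V)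
    (natural : ∀ {V W : FGProj R} (f : V ⟶ W) v v' v'',
      (G.map f).hom (T V v v' v'') = T W (f.hom.hom v) (f.hom.hom v') (f.hom.hom v''))
    (mem_range : ∀ V v v' v'', T V v v' v'' ∈ Set.range (b.app V).hom)
    (axis₀ : ∀ V v, T V v 0 0 = 0) (axis₁ : ∀ V v, T V 0 v 0 = 0) (axis₂ : ∀ V v, T V 0 0 v = 0)
    (V : FGProj R) (v v' v'' : V.obj) : T V v v' v'' = 0 := by
  refine eq_zero_of_forall_single_eq_zero b (n := 3) (fun V v => T V (v 0) (v 1) (v 2))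
    (fun f v => natural f _ _ _) (fun V v => mem_range V _ _ _) (fun V j v => ?_) V ![v, v', v'']
  fin_cases j
  · exact axis₀ V v
  · exact axis₁ V v
  · exact axis₂ V v

end ProjFunctor

/-! ### Existence of splittings -/

/-- A normalised symmetric 2-cocycle on an abelian group `A` with values in `B`. -/
structure SymmCocycle (A B : Type*) [AddCommGroup A] [AddCommGroup B] where
  toFun : A → A → B
  apply_zero : ∀ x, toFun x 0 = 0
  symm : ∀ x y, toFun x y = toFun y x
  cocycle : ∀ x y z, toFun x y + toFun (x + y) z = toFun y z + toFun x (y + z)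

/-- The abelian extension of `A` by `B` defined by a symmetric cocycle `γ`: the set `A × B` with the
addition `(a, b) + (a', b') = (a + a', b + b' + γ(a, a'))`. -/
@[ext]
structure TwistedSum {A B : Type*} [AddCommGroup A] [AddCommGroup B] (γ : SymmCocycle A B) where
  fst : A
  snd : B

namespace TwistedSum

variable {A B : Type*} [AddCommGroup A] [AddCommGroup B] {γ : SymmCocycle A B}

instance : Add (TwistedSum γ) :=
  ⟨fun x y => ⟨x.fst + y.fst, x.snd + y.snd + γ.toFun x.fst y.fst⟩⟩

instance : Zero (TwistedSum γ) := ⟨⟨0, 0⟩⟩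

instance : Neg (TwistedSum γ) := ⟨fun x => ⟨-x.fst, -x.snd - γ.toFun x.fst (-x.fst)⟩⟩

theorem fst_add (x y : TwistedSum γ) : (x + y).fst = x.fst + y.fst := rfl

theorem snd_add (x y : TwistedSum γ) :
    (x + y).snd = x.snd + y.snd + γ.toFun x.fst y.fst := rfl

protected theorem add_comm (x y : TwistedSum γ) : x + y = y + x :=
  TwistedSum.ext (add_comm _ _) <| by rw [snd_add, snd_add, γ.symm, add_comm x.snd]

protected theorem add_zero (x : TwistedSum γ) : x + 0 = x :=
  TwistedSum.ext (add_zero _) <|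
    (congrArg _ (γ.apply_zero x.fst)).trans ((add_zero _).trans (add_zero _))

protected theorem add_neg_cancel (x : TwistedSum γ) : x + -x = 0 :=
  TwistedSum.ext (add_neg_cancel _) <|
    show x.snd + (-x.snd - γ.toFun x.fst (-x.fst)) + γ.toFun x.fst (-x.fst) = 0 by abel

protected theorem add_assoc (x y z : TwistedSum γ) : x + y + z = x + (y + z) :=
  TwistedSum.ext (add_assoc _ _ _) <| by
    simp only [snd_add, fst_add]
    rw [eq_sub_of_add_eq (γ.cocycle x.fst y.fst z.fst)]
    abel

instance : AddCommGroup (TwistedSum γ) where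
  add_assoc := TwistedSum.add_assoc
  zero_add x := (TwistedSum.add_comm 0 x).trans x.add_zero
  add_zero := TwistedSum.add_zero
  add_comm := TwistedSum.add_comm
  neg_add_cancel x := (TwistedSum.add_comm (-x) x).trans x.add_neg_cancel
  nsmul := nsmulRec
  zsmul := zsmulRec

end TwistedSum

namespace ElemExt

open ProjFunctor

variable {R : Type u} [CommRing R] {B : ProjFunctor R R} {φ : ElemExt (tautFunctor R) B}
  {o : φ.C₀.obj (𝟙_ (FGProj R))}

theorem a_yonedaEval (ho : (φ.a.app (𝟙_ _)).hom o = (1 : R)) {V : FGProj R} (v : V.obj) :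
    (φ.a.app V).hom (φ.C₀.yonedaEval o v) = v := by
  rw [app_yonedaEval, ho]
  exact one_smul R v

variable (φ o) in
/-- A natural lift to `C₁` of the additivity defect `[v] + [w] - [v + w]` of the family
`v ↦ [v]` of maps of sets `V → C₀(V)` corresponding to `o ∈ C₀(R)`, normalised to vanish when `v` or
`w` is zero. -/
structure DefectLift where
  toFun : ∀ V : FGProj R, V.obj → V.obj → φ.C₁.obj V
  map_apply : ∀ {V W : FGProj R} (f : V ⟶ W) v w,
    (φ.C₁.map f).hom (toFun V v w) = toFun W (f.hom.hom v) (f.hom.hom w)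
  d_apply : ∀ V v w, (φ.d.app V).hom (toFun V v w) =
    φ.C₀.yonedaEval o v + φ.C₀.yonedaEval o w - φ.C₀.yonedaEval o (v + w)
  apply_zero : ∀ V v, toFun V v 0 = 0
  zero_apply : ∀ V v, toFun V 0 v = 0

/-- It suffices to lift the defect of the standard basis of `R²`. -/
theorem nonempty_defectLift (ho : (φ.a.app (𝟙_ _)).hom o = (1 : R)) :
    Nonempty (φ.DefectLift o) := by
  let e := FGProj.stdBasis R (n := 2)
  obtain ⟨c, hc⟩ := (φ.exact₀ _ (φ.C₀.yonedaEval o (e 0) + φ.C₀.yonedaEval o (e 1) -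
    φ.C₀.yonedaEval o (e 0 + e 1))).1 (by
      rw [map_sub, map_add, a_yonedaEval ho, a_yonedaEval ho, a_yonedaEval ho]
      exact sub_self (e 0 + e 1))
  let T (V : FGProj R) (v w : V.obj) : φ.C₁.obj V := (φ.C₁.map (FGProj.tuple ![v, w])).hom c
  have map_T {V W : FGProj R} (f : V ⟶ W) v w :
      (φ.C₁.map f).hom (T V v w) = T W (f.hom.hom v) (f.hom.hom w) := by
    simp only [T, map_map_apply, FGProj.tuple_comp]
    congr 4
    funext j
    fin_cases j <;> rfl
  have T_zero (V : FGProj R) : T V 0 0 = 0 := by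
    have h : ![(0 : V.obj), 0] = fun _ => 0 := by funext j; fin_cases j <;> rfl
    simp only [T, h, FGProj.tuple_zero, φ.pointed₁.map_zero]
    rfl
  have d_T (V : FGProj R) (v w : V.obj) : (φ.d.app V).hom (T V v w) =
      φ.C₀.yonedaEval o v + φ.C₀.yonedaEval o w - φ.C₀.yonedaEval o (v + w) := by
    simp only [T, naturality_apply, hc, map_sub, map_add, map_yonedaEval, e,
      FGProj.tuple_stdBasis]
    rfl
  exact ⟨{
    toFun V v w := T V v w - T V v 0 - T V 0 w
    map_apply f v w := by simp only [map_sub, map_T, map_zero]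
    d_apply V v w := by
      simp only [map_sub, d_T, add_zero, zero_add, yonedaEval_zero φ.pointed₀]
      abel
    apply_zero V v := by rw [T_zero, sub_zero, sub_self]
    zero_apply V v := by rw [T_zero, sub_zero, sub_self] }⟩

namespace DefectLift

variable [B.Additive] (γ : φ.DefectLift o)

theorem symm (V : FGProj R) (v w : V.obj) : γ.toFun V v w = γ.toFun V w v := by
  refine sub_eq_zero.1 (eq_zero_of_axes₂ φ.b (fun V v w => γ.toFun V v w - γ.toFun V w v)
    (fun f v w => ?_) (fun V v w => (φ.exact₁ V _).1 ?_) (fun V v => ?_) (fun V v => ?_) V v w)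
  · simp only [map_sub, γ.map_apply]
  · rw [map_sub, γ.d_apply, γ.d_apply, add_comm v w]; abel
  · rw [γ.apply_zero, γ.zero_apply, sub_zero]
  · rw [γ.apply_zero, γ.zero_apply, sub_zero]

theorem cocycle (V : FGProj R) (v w z : V.obj) :
    γ.toFun V v w + γ.toFun V (v + w) z = γ.toFun V w z + γ.toFun V v (w + z) := by
  refine sub_eq_zero.1 (eq_zero_of_axes₃ φ.b
    (fun V v w z => γ.toFun V v w + γ.toFun V (v + w) z - (γ.toFun V w z + γ.toFun V v (w + z)))
    (fun f v w z => ?_) (fun V v w z => (φ.exact₁ V _).1 ?_)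
    (fun V v => ?_) (fun V v => ?_) (fun V v => ?_) V v w z)
  · simp only [map_sub, map_add, γ.map_apply]
  · simp only [map_sub, map_add, γ.d_apply, add_assoc v w z]; abel
  · simp only [γ.apply_zero, add_zero, sub_zero]
  · simp only [γ.apply_zero, γ.zero_apply, add_zero, zero_add, sub_zero]
  · simp only [γ.zero_apply, zero_add, add_zero, sub_self]

/-- The cocycle on `V` with values in `C₁(V)` given by a lift of the defect. -/
def symmCocycle (V : FGProj R) : SymmCocycle V.obj (φ.C₁.obj V) where
  toFun := γ.toFun V
  apply_zero := γ.apply_zero V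
  symm := γ.symm V
  cocycle := γ.cocycle V

/-- The functor sending `V` to the twisted sum of `V` and `C₁(V)`. -/
def twistedFunctor : ProjFunctor R ℤ where
  obj V := ModuleCat.of ℤ (TwistedSum (γ.symmCocycle V))
  map {V W} f := RingElemExt.intHom (N := ModuleCat.of ℤ (TwistedSum (γ.symmCocycle V)))
    (N' := ModuleCat.of ℤ (TwistedSum (γ.symmCocycle W))) <| AddMonoidHom.mk'
      (fun x : TwistedSum (γ.symmCocycle V) =>
        (⟨f.hom.hom x.fst, (φ.C₁.map f).hom x.snd⟩ : TwistedSum (γ.symmCocycle W)))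
      (fun x y => TwistedSum.ext (map_add f.hom.hom x.fst y.fst) <| by
        simp only [TwistedSum.snd_add, map_add]
        exact congrArg _ (γ.map_apply f x.fst y.fst))
  map_id V := ModuleCat.hom_ext (LinearMap.ext fun x : TwistedSum (γ.symmCocycle V) =>
    TwistedSum.ext rfl (map_id_apply x.snd))
  map_comp f g := ModuleCat.hom_ext (LinearMap.ext fun x : TwistedSum (γ.symmCocycle _) =>
    TwistedSum.ext rfl (map_map_apply f g x.snd).symm)

/-- The map `c ↦ (0, c)` from `C₁` to the twisted sums. -/
def inr : (φ.restrict (Int.castRingHom R)).C₁ ⟶ γ.twistedFunctor where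
  app V := RingElemExt.intHom (N := (φ.restrict (Int.castRingHom R)).C₁.obj V)
    (N' := γ.twistedFunctor.obj V) <| AddMonoidHom.mk'
      (fun c => (⟨0, c⟩ : TwistedSum (γ.symmCocycle V)))
      (fun _ _ => TwistedSum.ext (add_zero (0 : V.obj)).symm <|
        ((congrArg _ (γ.apply_zero V 0)).trans (add_zero _)).symm)
  naturality _ _ f := ModuleCat.hom_ext (LinearMap.ext fun _ =>
    TwistedSum.ext (map_zero f.hom.hom).symm rfl)

/-- The map `(v, c) ↦ [v] + d c` from the twisted sums to `C₀`. -/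
def toC₀ : γ.twistedFunctor ⟶ (φ.restrict (Int.castRingHom R)).C₀ where
  app V := RingElemExt.intHom (N := γ.twistedFunctor.obj V)
    (N' := (φ.restrict (Int.castRingHom R)).C₀.obj V) <| AddMonoidHom.mk'
      (fun x : TwistedSum (γ.symmCocycle V) =>
        φ.C₀.yonedaEval o x.fst + (φ.d.app V).hom x.snd)
      (fun x y : TwistedSum (γ.symmCocycle V) => by
        change φ.C₀.yonedaEval o (x.fst + y.fst) +
          (φ.d.app V).hom (x.snd + y.snd + γ.toFun V x.fst y.fst) = _
        rw [map_add, map_add, γ.d_apply]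
        abel)
  naturality V W f := ModuleCat.hom_ext (LinearMap.ext fun x : TwistedSum (γ.symmCocycle V) => by
    change φ.C₀.yonedaEval o (f.hom.hom x.fst) + (φ.d.app W).hom ((φ.C₁.map f).hom x.snd) =
      (φ.C₀.map f).hom (φ.C₀.yonedaEval o x.fst + (φ.d.app V).hom x.snd)
    rw [map_add, map_yonedaEval, naturality_apply])

variable {γ} in
theorem toC₀_apply {V : FGProj R} (x : TwistedSum (γ.symmCocycle V)) :
    (γ.toC₀.app V).hom x = φ.C₀.yonedaEval o x.fst + (φ.d.app V).hom x.snd := rfl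

theorem a_toC₀ (ho : (φ.a.app (𝟙_ _)).hom o = (1 : R)) {V : FGProj R}
    (x : TwistedSum (γ.symmCocycle V)) : (φ.a.app V).hom ((γ.toC₀.app V).hom x) = x.fst := by
  rw [toC₀_apply, map_add, a_yonedaEval ho, (φ.exact₀ V).apply_apply_eq_zero]
  exact add_zero x.fst

/-- The splitting of `e_* φ` formed by the twisted sums. -/
def splitting (ho : (φ.a.app (𝟙_ _)).hom o = (1 : R)) :
    (φ.restrict (Int.castRingHom R)).Splitting where
  X := γ.twistedFunctor
  pointed V hV :=
    have := φ.pointed₁ V hV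
    ⟨fun x y : TwistedSum (γ.symmCocycle V) =>
      TwistedSum.ext (Subsingleton.elim x.fst y.fst) (Subsingleton.elim x.snd y.snd)⟩
  c₁ := γ.inr
  c₀ := γ.toC₀
  comp := NatTrans.ext (funext fun V => ModuleCat.hom_ext (LinearMap.ext fun c =>
    (congrArg (· + (φ.d.app V).hom c) (yonedaEval_zero φ.pointed₀ o V)).trans (zero_add _)))
  cartesian V x := by
    rintro ⟨c, hc⟩
    have fst_eq_zero : TwistedSum.fst x = (0 : V.obj) := by
      rw [← γ.a_toC₀ ho x, ← hc]
      exact (φ.exact₀ V).apply_apply_eq_zero c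
    exact ⟨TwistedSum.snd x, TwistedSum.ext fst_eq_zero.symm rfl,
      fun c h => congrArg TwistedSum.snd h⟩
  c₀_surjective V (y : φ.C₀.obj V) := by
    let v : V.obj := (φ.a.app V).hom y
    obtain ⟨c, hc⟩ := (φ.exact₀ V (y - φ.C₀.yonedaEval o v)).1 (by
      rw [map_sub, a_yonedaEval ho]
      exact sub_self v)
    exact ⟨(⟨v, c⟩ : TwistedSum (γ.symmCocycle V)),
      (congrArg _ hc).trans (add_sub_cancel (φ.C₀.yonedaEval o v) y)⟩

end DefectLift

theorem nonempty_splitting [B.Additive] (φ : ElemExt (tautFunctor R) B) :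
    Nonempty (φ.restrict (Int.castRingHom R)).Splitting := by
  obtain ⟨o, ho⟩ := φ.a_surjective (𝟙_ _) (1 : R)
  obtain ⟨γ⟩ := nonempty_defectLift ho
  exact ⟨γ.splitting ho⟩

end ElemExt

instance bimodFunctor_additive {R : Type u} [CommRing R] (M : Type u) [AddCommGroup M] [Module R M]
    [Module Rᵐᵒᵖ M] [SMulCommClass R Rᵐᵒᵖ M] : (bimodFunctor R M).Additive where
  map_add {_ _ f g} := ModuleCat.hom_ext (LinearMap.ext fun x =>
    LinearMap.congr_fun (LinearMap.lTensor_add M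
      ((ModuleCat.restrictScalars ((RingEquiv.toOpposite R).symm : Rᵐᵒᵖ →+* R)).map f.hom).hom
      ((ModuleCat.restrictScalars ((RingEquiv.toOpposite R).symm : Rᵐᵒᵖ →+* R)).map g.hom).hom) x)

/-! ### The structure of a splitting -/

namespace RingElemExt

open ProjFunctor

variable {R : Type u} [CommRing R] {M : Type u} [AddCommGroup M] [Module R M] [Module Rᵐᵒᵖ M]
  [SMulCommClass R Rᵐᵒᵖ M] {φ : RingElemExt R M} {X : φ.eStar.Splitting}

theorem map_incl {V W : FGProj R} (f : V ⟶ W) (c : φ.C₁.obj V) :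
    (X.X.map f).hom (incl X V c) = incl X W ((φ.C₁.map f).hom c) :=
  (naturality_apply X.c₁ f c).symm

theorem proj_map {V W : FGProj R} (f : V ⟶ W) (x : X.X.obj V) :
    proj X W ((X.X.map f).hom x) = (φ.C₀.map f).hom (proj X V x) :=
  naturality_apply X.c₀ f x

theorem incl_injective (V : FGProj R) : Function.Injective (incl X V) := fun _ c' h =>
  (X.cartesian V (incl X V c') ⟨c', (proj_incl X V c').symm⟩).unique h rfl

theorem proj_yonedaEval (t : X.X.obj (𝟙_ (FGProj R))) {V : FGProj R} (v : V.obj) :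
    proj X V (X.X.yonedaEval t v) = φ.C₀.yonedaEval (proj X _ t) v :=
  app_yonedaEval X.c₀ t v

theorem act_map (f : End X.X) {V W : FGProj R} (g : V ⟶ W) (x : X.X.obj V) :
    act X f W ((X.X.map g).hom x) = (X.X.map g).hom (act X f V x) :=
  naturality_apply (F := X.X) (G := X.X) f g x

theorem act_yonedaEval (f : End X.X) (t : X.X.obj (𝟙_ (FGProj R))) {V : FGProj R} (v : V.obj) :
    act X f V (X.X.yonedaEval t v) = X.X.yonedaEval (act X f _ t) v :=
  act_map f _ t

variable (X) in
/-- The map `a ∘ c₀ : X(V) → V` of abelian groups. -/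
def aug (V : FGProj R) : X.X.obj V →+ V.obj :=
  AddMonoidHom.comp (φ.a.app V).hom.toAddMonoidHom (proj X V)

theorem aug_map {V W : FGProj R} (f : V ⟶ W) (x : X.X.obj V) :
    aug X W ((X.X.map f).hom x) = f.hom.hom (aug X V x) :=
  naturality_apply (X.c₀ ≫ φ.eStar.a) f x

theorem aug_incl (V : FGProj R) (c : φ.C₁.obj V) : aug X V (incl X V c) = 0 :=
  (congrArg (φ.a.app V).hom (proj_incl X V c)).trans ((φ.exact₀ V).apply_apply_eq_zero c)

theorem exists_incl_eq {V : FGProj R} {x : X.X.obj V} (hx : aug X V x = 0) :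
    ∃ c : φ.C₁.obj V, incl X V c = x :=
  (X.cartesian V x ((φ.exact₀ V _).1 hx)).exists

theorem exists_incl_b_eq {V : FGProj R} {x : X.X.obj V} (hx : proj X V x = 0) :
    ∃ y, incl X V ((φ.b.app V).hom y) = x := by
  obtain ⟨c, rfl⟩ := exists_incl_eq (x := x) ((congrArg (φ.a.app V).hom hx).trans (map_zero _))
  rw [proj_incl] at hx
  obtain ⟨y, rfl⟩ := (φ.exact₁ V c).1 hx
  exact ⟨y, rfl⟩

variable (X) in
theorem exists_proj_eq (y : φ.C₀.obj (𝟙_ (FGProj R))) : ∃ u, proj X (𝟙_ _) u = y :=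
  X.c₀_surjective _ y

variable (X) in
theorem exists_aug_eq_one : ∃ u, aug X (𝟙_ (FGProj R)) u = (1 : R) := by
  obtain ⟨o, ho⟩ := φ.a_surjective (𝟙_ _) (1 : R)
  obtain ⟨u, hu⟩ := exists_proj_eq X o
  exact ⟨u, (congrArg (φ.a.app _).hom hu).trans ho⟩

section Decomposition

variable {u : X.X.obj (𝟙_ (FGProj R))} (hu : aug X (𝟙_ _) u = (1 : R))

include hu

theorem aug_yonedaEval {V : FGProj R} (v : V.obj) : aug X V (X.X.yonedaEval u v) = v := by
  rw [yonedaEval, aug_map, hu]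
  exact one_smul R v

theorem exists_incl_eq_sub {V : FGProj R} (x : X.X.obj V) :
    ∃ c, incl X V c = x - X.X.yonedaEval u (aug X V x) :=
  exists_incl_eq (by rw [map_sub, aug_yonedaEval hu, sub_self])

theorem splitting_induction {V : FGProj R} {p : X.X.obj V → Prop} (x : X.X.obj V)
    (yonedaEval : ∀ v, p (X.X.yonedaEval u v)) (incl : ∀ c : φ.C₁.obj V, p (incl X V c))
    (add : ∀ x y, p x → p y → p (x + y)) : p x := by
  obtain ⟨c, hc⟩ := exists_incl_eq_sub hu x
  rw [← sub_add_cancel x (X.X.yonedaEval u (aug X V x)), ← hc]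
  exact add _ _ (incl c) (yonedaEval _)

theorem RegularOver.ext {f g : End X.X} {r : R} (hf : RegularOver X f r) (hg : RegularOver X g r)
    (h : act X f _ u = act X g _ u) : f = g :=
  act_ext X fun V x => splitting_induction hu (p := fun x => act X f V x = act X g V x) x
    (fun v => by rw [act_yonedaEval, act_yonedaEval, h]) (fun c => by rw [hf.1, hg.1])
    fun x y hx hy => by rw [map_add, map_add, hx, hy]

/-- The element `c ∈ C₁(V)` in the decomposition `x = [v] + c₁(c)`, `v ∈ V`, of `x ∈ X(V)`. Here
`[v]` is the value at `v` of the family corresponding to `u`. -/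
def remainder (V : FGProj R) (x : X.X.obj V) : φ.C₁.obj V :=
  (exists_incl_eq_sub hu x).choose

theorem incl_remainder {V : FGProj R} (x : X.X.obj V) :
    incl X V (remainder hu V x) = x - X.X.yonedaEval u (aug X V x) :=
  (exists_incl_eq_sub hu x).choose_spec

theorem remainder_incl {V : FGProj R} (c : φ.C₁.obj V) : remainder hu V (incl X V c) = c :=
  incl_injective V <| by rw [incl_remainder, aug_incl, yonedaEval_zero X.pointed, sub_zero]

theorem remainder_yonedaEval {V : FGProj R} (v : V.obj) :
    remainder hu V (X.X.yonedaEval u v) = 0 :=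
  incl_injective V <| by rw [incl_remainder, aug_yonedaEval hu, sub_self, map_zero]

theorem remainder_self : remainder hu _ u = 0 :=
  (congrArg (remainder hu _) (yonedaEval_one u)).symm.trans (remainder_yonedaEval hu (V := 𝟙_ _) 1)

theorem map_remainder {V W : FGProj R} (f : V ⟶ W) (x : X.X.obj V) :
    (φ.C₁.map f).hom (remainder hu V x) = remainder hu W ((X.X.map f).hom x) :=
  incl_injective W <| by
    rw [incl_remainder, ← map_incl, incl_remainder, map_sub, map_yonedaEval, aug_map]

theorem d_remainder {V : FGProj R} (x : X.X.obj V) :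
    (φ.d.app V).hom (remainder hu V x) =
      proj X V x - φ.C₀.yonedaEval (proj X _ u) (aug X V x) := by
  rw [← proj_incl, incl_remainder, map_sub, proj_yonedaEval]

/-- The additivity defect `[v] + [w] - [v + w]` in `X(V)`, as an element of `C₁(V)`. -/
def defect (V : FGProj R) (v w : V.obj) : φ.C₁.obj V :=
  remainder hu V (X.X.yonedaEval u v + X.X.yonedaEval u w)

theorem incl_defect {V : FGProj R} (v w : V.obj) : incl X V (defect hu V v w) =
    X.X.yonedaEval u v + X.X.yonedaEval u w - X.X.yonedaEval u (v + w) := by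
  rw [defect, incl_remainder, map_add, aug_yonedaEval hu, aug_yonedaEval hu]

theorem map_defect {V W : FGProj R} (f : V ⟶ W) (v w : V.obj) :
    (φ.C₁.map f).hom (defect hu V v w) = defect hu W (f.hom.hom v) (f.hom.hom w) := by
  rw [defect, map_remainder, map_add, map_yonedaEval, map_yonedaEval]
  rfl

theorem d_defect {V : FGProj R} (v w : V.obj) : (φ.d.app V).hom (defect hu V v w) =
    φ.C₀.yonedaEval (proj X _ u) v + φ.C₀.yonedaEval (proj X _ u) w -
      φ.C₀.yonedaEval (proj X _ u) (v + w) := by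
  rw [← proj_incl, incl_defect, map_sub, map_add, proj_yonedaEval, proj_yonedaEval,
    proj_yonedaEval]

theorem defect_zero_right (V : FGProj R) (v : V.obj) : defect hu V v 0 = 0 :=
  incl_injective V <| by
    rw [incl_defect, yonedaEval_zero X.pointed, add_zero, add_zero, sub_self, map_zero]

theorem defect_zero_left (V : FGProj R) (v : V.obj) : defect hu V 0 v = 0 :=
  incl_injective V <| by
    rw [incl_defect, yonedaEval_zero X.pointed, zero_add, zero_add, sub_self, map_zero]

theorem remainder_add {V : FGProj R} (x y : X.X.obj V) : remainder hu V (x + y) =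
    remainder hu V x + remainder hu V y + defect hu V (aug X V x) (aug X V y) :=
  incl_injective (X := X) V <| by
    rw [map_add, map_add, incl_remainder, incl_remainder, incl_remainder, incl_defect, map_add]
    abel

/-- The universal property of `X`: it is generated by `C₁` and the element `u`, subject to the
relations expressing that the defect of `u` comes from `C₁`. -/
theorem exists_hom_of_defect {Y : ProjFunctor R ℤ} (g : φ.eStar.C₁ ⟶ Y) (w : Y.obj (𝟙_ _))
    (h : ∀ (V : FGProj R) (v v' : V.obj), (g.app V).hom (defect hu V v v') =
      Y.yonedaEval w v + Y.yonedaEval w v' - Y.yonedaEval w (v + v')) :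
    ∃ f : X.X ⟶ Y, X.c₁ ≫ f = g ∧ (f.app _).hom u = w := by
  let G (V : FGProj R) : φ.C₁.obj V →+ Y.obj V := (g.app V).hom.toAddMonoidHom
  have hG (V : FGProj R) (v v' : V.obj) : G V (defect hu V v v') =
    Y.yonedaEval w v + Y.yonedaEval w v' - Y.yonedaEval w (v + v') := h V v v'
  have map_G {V W : FGProj R} (k : V ⟶ W) (c : φ.C₁.obj V) :
    (Y.map k).hom (G V c) = G W ((φ.C₁.map k).hom c) := (naturality_apply g k c).symm
  have w_zero (V : FGProj R) : Y.yonedaEval w (0 : V.obj) = 0 := by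
    have defect_zero := hG V 0 0
    rwa [defect_zero_left, add_zero, add_sub_cancel_right, map_zero, eq_comm] at defect_zero
  let F (V : FGProj R) : X.X.obj V →+ Y.obj V := AddMonoidHom.mk'
    (fun x => Y.yonedaEval w (aug X V x) + G V (remainder hu V x)) fun x y => by
      rw [remainder_add, map_add, map_add, map_add, hG]
      abel
  refine ⟨{ app V := intHom (F V), naturality V W k := ?_ }, ?_, ?_⟩
  · refine ModuleCat.hom_ext (LinearMap.ext fun x => ?_)
    change Y.yonedaEval w (aug X W ((X.X.map k).hom x)) + G W (remainder hu W ((X.X.map k).hom x)) =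
      (Y.map k).hom (Y.yonedaEval w (aug X V x) + G V (remainder hu V x))
    rw [map_add, map_yonedaEval, aug_map, ← map_remainder, map_G]
  · refine NatTrans.ext (funext fun V => ModuleCat.hom_ext (LinearMap.ext
      fun c : φ.C₁.obj V => ?_))
    change Y.yonedaEval w (aug X V (incl X V c)) + G V (remainder hu V (incl X V c)) = G V c
    rw [aug_incl, w_zero, zero_add, remainder_incl]
  · change Y.yonedaEval w (aug X _ u) + G _ (remainder hu _ u) = w
    rw [hu, yonedaEval_one, remainder_self, map_zero, add_zero]

theorem incl_smul_defect {w : X.X.obj (𝟙_ (FGProj R))} {r : R}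
    (hw : proj X _ w = r • proj X _ u) (V : FGProj R) (v v' : V.obj) :
    incl X V (r • defect hu V v v') =
      X.X.yonedaEval w v + X.X.yonedaEval w v' - X.X.yonedaEval w (v + v') := by
  have proj_w {V : FGProj R} (v : V.obj) :
      proj X V (X.X.yonedaEval w v) = r • φ.C₀.yonedaEval (proj X _ u) v := by
    rw [proj_yonedaEval, hw, yonedaEval_smul]
  refine (sub_eq_zero.1 (eq_zero_of_axes₂ (φ.eStar.b ≫ X.c₁)
    (fun V v v' => X.X.yonedaEval w v + X.X.yonedaEval w v' - X.X.yonedaEval w (v + v') -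
      incl X V (r • defect hu V v v'))
    (fun f v v' => ?_) (fun V v v' => exists_incl_b_eq ?_)
    (fun V v => ?_) (fun V v => ?_) V v v')).symm
  · simp only [map_sub, map_add, map_incl, map_smul, map_yonedaEval, map_defect]
  · rw [map_sub, map_sub, map_add, proj_w, proj_w, proj_w, proj_incl, map_smul, d_defect, smul_sub,
      smul_add, sub_self]
  · rw [defect_zero_right, smul_zero, map_zero, yonedaEval_zero X.pointed, add_zero, add_zero,
      sub_self, sub_zero]
  · rw [defect_zero_left, smul_zero, map_zero, yonedaEval_zero X.pointed, zero_add, zero_add,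
      sub_self, sub_zero]

omit hu in
variable (X) in
theorem exists_regularOver (r : R) : ∃ f : End X.X, RegularOver X f r := by
  obtain ⟨u, hu⟩ := exists_aug_eq_one X
  obtain ⟨w, hw⟩ := exists_proj_eq X (r • proj X _ u)
  obtain ⟨f, hf, hfu⟩ := exists_hom_of_defect hu (restrMap (Int.castRingHom R) (r • 𝟙 φ.C₁) ≫ X.c₁)
    w (incl_smul_defect hu hw)
  have act_incl (V : FGProj R) (c : φ.C₁.obj V) : act X f V (incl X V c) = incl X V (r • c) :=
    congrArg (fun t : φ.eStar.C₁ ⟶ X.X => (t.app V).hom c) hf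
  refine ⟨f, act_incl, fun V x => splitting_induction hu
    (p := fun x => proj X V (act X f V x) = r • proj X V x) x (fun v => ?_) (fun c => ?_)
    fun x y hx hy => by rw [map_add, map_add, hx, hy, map_add, smul_add]⟩
  · have act_u : act X f _ u = w := hfu
    rw [act_yonedaEval, act_u, proj_yonedaEval, hw, yonedaEval_smul, proj_yonedaEval]
  · rw [act_incl, proj_incl, map_smul, proj_incl]

end Decomposition

end RingElemExt

/-! ### The ring of regular endomorphisms -/

section SquareZero

variable {R : Type u} [CommRing R] {M : Type u} [AddCommGroup M] [Module R M] [Module Rᵐᵒᵖ M]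
  [SMulCommClass R Rᵐᵒᵖ M]

variable (R) in
/-- The unit object of `R-proj`, considered as an `Rᵐᵒᵖ`-module, is `Rᵐᵒᵖ`. -/
def opModuleUnitEquiv : opModule (𝟙_ (FGProj R)).obj ≃ₗ[Rᵐᵒᵖ] Rᵐᵒᵖ where
  toFun := op (α := R)
  map_add' _ _ := rfl
  map_smul' s (r : R) := congrArg op (mul_comm s.unop r)
  invFun s := (s.unop : R)
  left_inv _ := rfl
  right_inv _ := rfl

theorem bimodMk_one_bijective :
    Function.Bijective fun m : M => bimodMk m (𝟙_ (FGProj R)) (1 : R) :=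
  ((LinearEquiv.lTensor M (opModuleUnitEquiv R)).trans (TensorProduct.rid Rᵐᵒᵖ M)).symm.bijective

theorem bimodMk_smul (m : M) (r : R) {V : FGProj R} (v : V.obj) :
    bimodMk m V (r • v) = bimodMk (op r • m) V v :=
  (TensorProduct.smul_tmul (R := Rᵐᵒᵖ) (op r) m _).symm

theorem smul_bimodMk (m : M) (r : R) {V : FGProj R} (v : V.obj) :
    r • bimodMk m V v = bimodMk (r • m) V v :=
  smul_bimodTmul M r m v

namespace RingElemExt

variable {φ : RingElemExt R M} (X : φ.eStar.Splitting)

theorem act_kernelEnd_of_aug_eq_one {u : X.X.obj (𝟙_ (FGProj R))} (hu : aug X _ u = (1 : R))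
    (m : M) : act X (kernelEnd X m) _ u = incl X _ ((φ.b.app _).hom (bimodMk m _ (1 : R))) :=
  congrArg (fun r : R => incl X _ ((φ.b.app _).hom (bimodMk m (𝟙_ (FGProj R)) r))) hu

theorem regularProj_eq {f : regularRing X} {r : R} (hf : RegularOver X f.1 r) :
    regularProj X f = r :=
  (regularProj_spec X f).unique hf

theorem regularIncl_injective : Function.Injective (regularIncl X) := fun m m' h => by
  obtain ⟨u, hu⟩ := exists_aug_eq_one X
  have act_u : act X (kernelEnd X m) _ u = act X (kernelEnd X m') _ u :=
    congrArg (fun f : regularRing X => act X f.1 _ u) h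
  rw [act_kernelEnd_of_aug_eq_one X hu, act_kernelEnd_of_aug_eq_one X hu] at act_u
  exact bimodMk_one_bijective.injective (φ.b_injective _ (incl_injective _ act_u))

theorem exact_regularIncl_regularProj :
    Function.Exact (regularIncl X) (regularProj X) := fun f => by
  refine ⟨fun hf => ?_, ?_⟩
  · obtain ⟨u, hu⟩ := exists_aug_eq_one X
    have f_over_zero : RegularOver X f.1 0 := hf ▸ regularProj_spec X f
    obtain ⟨y, hy⟩ := exists_incl_b_eq (x := act X f.1 _ u) (by rw [f_over_zero.2, zero_smul])
    obtain ⟨m, rfl⟩ := bimodMk_one_bijective.surjective y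
    exact ⟨m, Subtype.ext <| (kernelEnd_regular X m).ext hu f_over_zero <|
      (act_kernelEnd_of_aug_eq_one X hu m).trans hy⟩
  · rintro ⟨m, rfl⟩
    exact regularProj_eq X (kernelEnd_regular X m)

theorem regularProj_surjective : Function.Surjective (regularProj X) := fun r => by
  obtain ⟨f, hf⟩ := exists_regularOver X r
  exact ⟨⟨f, r, hf⟩, regularProj_eq X hf⟩

variable {X} in
theorem RegularOver.kernelEnd_mul {f : End X.X} {r : R} (hf : RegularOver X f r) (m : M) :
    kernelEnd X m * f = kernelEnd X (op r • m) :=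
  act_ext X fun V x => by
    rw [act_mul, act_kernelEnd, act_kernelEnd, hf.2, map_smul]
    exact congrArg (fun t => incl X V ((φ.b.app V).hom t)) (bimodMk_smul m r _)

variable {X} in
theorem RegularOver.mul_kernelEnd {f : End X.X} {r : R} (hf : RegularOver X f r) (m : M) :
    f * kernelEnd X m = kernelEnd X (r • m) :=
  act_ext X fun V x => by
    rw [act_mul, act_kernelEnd, act_kernelEnd, hf.1, ← map_smul, smul_bimodMk]

theorem isSquareZeroExtension : IsSquareZeroExtension (regularIncl X) (regularProj X) where
  injective := regularIncl_injective X
  exact := exact_regularIncl_regularProj X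
  surjective := regularProj_surjective X
  right m f := Subtype.ext ((regularProj_spec X f).kernelEnd_mul m)
  left m f := Subtype.ext ((regularProj_spec X f).mul_kernelEnd m)
  square_zero m m' := Subtype.ext <|
    ((kernelEnd_regular X m).mul_kernelEnd m').trans <| by
      rw [zero_smul]
      exact congrArg Subtype.val (map_zero (regularIncl X))

end RingElemExt

end SquareZero

/-! ### Products on a splitting -/

section Products

open ProjFunctor

variable {R : Type u} [CommRing R] {S : Type w} [Ring S]

section

variable {F : ProjFunctor R S} (ν : FunctorMul F)

theorem FunctorMul.mul_yonedaEval {V W : FGProj R} (x : F.obj V) (w : W.obj) :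
    ν.mul V W x (F.yonedaEval ν.one w) = (F.map (FGProj.tensorRight V w)).hom x := by
  conv_rhs => rw [← ν.mul_one V x, map_map_apply, FGProj.rightUnitor_comp_tensorRight, ν.map_mul,
    map_id_apply]
  rfl

theorem FunctorMul.yonedaEval_mul {V W : FGProj R} (v : V.obj) (y : F.obj W) :
    ν.mul V W (F.yonedaEval ν.one v) y = (F.map (FGProj.tensorLeft W v)).hom y := by
  conv_rhs => rw [← ν.one_mul W y, map_map_apply, FGProj.leftUnitor_comp_tensorLeft, ν.map_mul,
    map_id_apply]
  rfl

end

section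

variable {F₁ F₀ : ProjFunctor R S} {d : F₁ ⟶ F₀} (ν : ComplexMul d)

theorem ComplexMul.mul₁₀_yonedaEval {V W : FGProj R} (c : F₁.obj V) (w : W.obj) :
    ν.mul₁₀ V W c (F₀.yonedaEval ν.one w) = (F₁.map (FGProj.tensorRight V w)).hom c := by
  conv_rhs => rw [← ν.mul₁₀_one V c, map_map_apply, FGProj.rightUnitor_comp_tensorRight,
    ν.map_mul₁₀, map_id_apply]
  rfl

theorem ComplexMul.yonedaEval_mul₀₁ {V W : FGProj R} (v : V.obj) (c : F₁.obj W) :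
    ν.mul₀₁ V W (F₀.yonedaEval ν.one v) c = (F₁.map (FGProj.tensorLeft W v)).hom c := by
  conv_rhs => rw [← ν.one_mul₀₁ W c, map_map_apply, FGProj.leftUnitor_comp_tensorLeft,
    ν.map_mul₀₁, map_id_apply]
  rfl

end

/-- A multiplicative structure on a splitting is determined by its products on `X`: the remaining
ones are those of `C₁` over `C₀`. -/
def ElemExt.Splitting.mulOfFunctorMul {A B : ProjFunctor R S} {φ : ElemExt A B} {α : FunctorMul A}
    (X : φ.Splitting) (μ : φ.Mul α) (ν : FunctorMul X.X)
    (c₀_one : (X.c₀.app (𝟙_ _)).hom ν.one = μ.one)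
    (c₀_mul : ∀ V W (x : X.X.obj V) (y : X.X.obj W), (X.c₀.app (V ⊗ W)).hom (ν.mul V W x y) =
      μ.mul V W ((X.c₀.app V).hom x) ((X.c₀.app W).hom y))
    (mul_c₁ : ∀ V W (x : X.X.obj V) (c : φ.C₁.obj W), ν.mul V W x ((X.c₁.app W).hom c) =
      (X.c₁.app (V ⊗ W)).hom (μ.mul₀₁ V W ((X.c₀.app V).hom x) c))
    (c₁_mul : ∀ V W (c : φ.C₁.obj V) (x : X.X.obj W), ν.mul V W ((X.c₁.app V).hom c) x =
      (X.c₁.app (V ⊗ W)).hom (μ.mul₁₀ V W c ((X.c₀.app W).hom x))) : X.Mul μ where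
  toFunctorMul := ν
  mul₀₁ V W := (μ.mul₀₁ V W).comp (X.c₀.app V).hom.toAddMonoidHom
  mul₁₀ V W := (AddMonoidHom.compHom' (X.c₀.app W).hom.toAddMonoidHom).comp (μ.mul₁₀ V W)
  smul_mul₀₁ V W s x c := (congrArg (μ.mul₀₁ V W · c) ((X.c₀.app V).hom.map_smul s x)).trans
    (μ.smul_mul₀₁ V W s _ c)
  mul₀₁_smul V W s x c := μ.mul₀₁_smul V W s _ c
  smul_mul₁₀ V W s c x := μ.smul_mul₁₀ V W s c _
  mul₁₀_smul V W s c x := (congrArg (μ.mul₁₀ V W c) ((X.c₀.app W).hom.map_smul s x)).trans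
    (μ.mul₁₀_smul V W s c _)
  map_mul₀₁ f g x c := (μ.map_mul₀₁ f g _ c).trans
    (congrArg (μ.mul₀₁ _ _ · _) (naturality_apply X.c₀ f x).symm)
  map_mul₁₀ f g c x := (μ.map_mul₁₀ f g c _).trans
    (congrArg (μ.mul₁₀ _ _ _) (naturality_apply X.c₀ g x).symm)
  assoc₀₀₁ U V W x y c := (congrArg (fun t => (φ.C₁.map (α_ U V W).hom).hom (μ.mul₀₁ _ W t c))
    (c₀_mul U V x y)).trans (μ.assoc₀₀₁ U V W _ _ c)
  assoc₀₁₀ U V W x c y := μ.assoc₀₁₀ U V W _ c _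
  assoc₁₀₀ U V W c x y := (μ.assoc₁₀₀ U V W c _ _).trans
    (congrArg (μ.mul₁₀ U _ c) (c₀_mul V W x y).symm)
  one_mul₀₁ V c := (congrArg (fun t => (φ.C₁.map (λ_ V).hom).hom (μ.mul₀₁ _ V t c)) c₀_one).trans
    (μ.one_mul₀₁ V c)
  mul₁₀_one V c := (congrArg (fun t => (φ.C₁.map (ρ_ V).hom).hom (μ.mul₁₀ V _ c t)) c₀_one).trans
    (μ.mul₁₀_one V c)
  leibniz₀₁ V W x c := (mul_c₁ V W x c).symm
  leibniz₁₀ V W c x := (c₁_mul V W c x).symm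
  leibniz₁₁ V W c c' := by
    have c₀_c₁ (V : FGProj R) (c : φ.C₁.obj V) :
        (X.c₀.app V).hom ((X.c₁.app V).hom c) = (φ.d.app V).hom c :=
      congrArg (fun t : φ.C₁ ⟶ φ.C₀ => (t.app V).hom c) X.comp
    refine Eq.trans ?_ (μ.leibniz₁₁ V W c c')
    exact congrArg₂ (fun s t => μ.mul₀₁ V W s c' - μ.mul₁₀ V W c t) (c₀_c₁ V c) (c₀_c₁ W c')
  c₀_one := c₀_one
  c₀_mul := c₀_mul
  id_mul₀₁ _ _ _ _ := rfl
  id_mul₁₀ _ _ _ _ := rfl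

end Products

namespace RingElemExt

open ProjFunctor

variable {R : Type u} [CommRing R] {M : Type u} [AddCommGroup M] [Module R M] [Module Rᵐᵒᵖ M]
  [SMulCommClass R Rᵐᵒᵖ M] {φ : RingElemExt R M} {μ : φ.Mul (tautMul R)} {X : φ.eStar.Splitting}

section SplitMul

variable {u : X.X.obj (𝟙_ (FGProj R))} (hu : proj X _ u = μ.one)

include hu

theorem aug_eq_one_of_proj_eq_one : aug X _ u = (1 : R) :=
  (congrArg (φ.a.app (𝟙_ _)).hom hu).trans μ.a_one

/-- The product on `X` with unit `u`. It is determined by `x · [w] = (id ⊗ w)_* x` and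
`x · c₁(c) = c₁(c₀(x) · c)`. -/
def splitMul {V W : FGProj R} (x : X.X.obj V) (y : X.X.obj W) : X.X.obj (V ⊗ W) :=
  (X.X.map (FGProj.tensorRight V (aug X W y))).hom x +
    incl X (V ⊗ W)
      (μ.mul₀₁ V W (proj X V x) (remainder (aug_eq_one_of_proj_eq_one hu) W y))

theorem map_tensorRight_eq {V W : FGProj R} (x : X.X.obj V) (w : W.obj) :
    (X.X.map (FGProj.tensorRight V w)).hom x =
      X.X.yonedaEval u (FGProj.tmul (aug X V x) w) +
        incl X (V ⊗ W) (μ.mul₁₀ V W (remainder (aug_eq_one_of_proj_eq_one hu) V x)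
          (φ.C₀.yonedaEval μ.one w)) := by
  rw [μ.mul₁₀_yonedaEval, ← map_incl, incl_remainder, map_sub, map_yonedaEval]
  exact (add_sub_cancel _ _).symm

theorem map_tensorLeft_eq {V W : FGProj R} (v : V.obj) (y : X.X.obj W) :
    (X.X.map (FGProj.tensorLeft W v)).hom y =
      X.X.yonedaEval u (FGProj.tmul v (aug X W y)) +
        incl X (V ⊗ W) (μ.mul₀₁ V W (φ.C₀.yonedaEval μ.one v)
          (remainder (aug_eq_one_of_proj_eq_one hu) W y)) := by
  rw [μ.yonedaEval_mul₀₁, ← map_incl, incl_remainder, map_sub, map_yonedaEval]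
  exact (add_sub_cancel _ _).symm

theorem splitMul_eq {V W : FGProj R} (x : X.X.obj V) (y : X.X.obj W) :
    splitMul hu x y = (X.X.map (FGProj.tensorLeft W (aug X V x))).hom y +
      incl X (V ⊗ W)
        (μ.mul₁₀ V W (remainder (aug_eq_one_of_proj_eq_one hu) V x) (proj X W y)) := by
  have e := μ.leibniz₁₁ V W (remainder (aug_eq_one_of_proj_eq_one hu) V x)
    (remainder (aug_eq_one_of_proj_eq_one hu) W y)
  rw [d_remainder, d_remainder, hu, map_sub, map_sub, AddMonoidHom.sub_apply, sub_sub_sub_comm,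
    sub_eq_zero, sub_eq_sub_iff_add_eq_add, add_comm] at e
  rw [splitMul, map_tensorRight_eq hu, map_tensorLeft_eq hu, add_assoc, add_assoc, ← map_add,
    ← map_add, e]

theorem splitMul_add_left {V W : FGProj R} (x x' : X.X.obj V) (y : X.X.obj W) :
    splitMul hu (x + x') y = splitMul hu x y + splitMul hu x' y := by
  rw [splitMul, map_add, map_add, map_add, AddMonoidHom.add_apply, map_add, add_add_add_comm]
  rfl

theorem splitMul_add_right {V W : FGProj R} (x : X.X.obj V) (y y' : X.X.obj W) :
    splitMul hu x (y + y') = splitMul hu x y + splitMul hu x y' := by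
  rw [splitMul_eq, splitMul_eq, splitMul_eq, map_add, map_add, map_add, map_add,
    add_add_add_comm]

theorem splitMul_incl {V W : FGProj R} (x : X.X.obj V) (c : φ.C₁.obj W) :
    splitMul hu x (incl X W c) = incl X (V ⊗ W) (μ.mul₀₁ V W (proj X V x) c) := by
  rw [splitMul, aug_incl, remainder_incl, FGProj.tensorRight_zero, X.pointed.map_zero]
  exact zero_add _

theorem incl_splitMul {V W : FGProj R} (c : φ.C₁.obj V) (y : X.X.obj W) :
    splitMul hu (incl X V c) y = incl X (V ⊗ W) (μ.mul₁₀ V W c (proj X W y)) := by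
  rw [splitMul_eq, aug_incl, remainder_incl, FGProj.tensorLeft_zero, X.pointed.map_zero]
  exact zero_add _

theorem splitMul_yonedaEval {V W : FGProj R} (x : X.X.obj V) (w : W.obj) :
    splitMul hu x (X.X.yonedaEval u w) = (X.X.map (FGProj.tensorRight V w)).hom x := by
  rw [splitMul, remainder_yonedaEval, aug_yonedaEval (aug_eq_one_of_proj_eq_one hu), map_zero,
    map_zero, add_zero]

theorem map_splitMul {V V' W W' : FGProj R} (f : V ⟶ V') (g : W ⟶ W') (x : X.X.obj V)
    (y : X.X.obj W) : (X.X.map (f ⊗ₘ g)).hom (splitMul hu x y) =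
      splitMul hu ((X.X.map f).hom x) ((X.X.map g).hom y) := by
  rw [splitMul, splitMul, map_add, map_incl, μ.map_mul₀₁, map_map_apply,
    FGProj.tensorRight_comp_tensorHom, map_map_apply, map_remainder, aug_map, proj_map]

theorem proj_splitMul {V W : FGProj R} (x : X.X.obj V) (y : X.X.obj W) :
    proj X (V ⊗ W) (splitMul hu x y) = μ.mul V W (proj X V x) (proj X W y) := by
  rw [splitMul, map_add, proj_map, ← μ.mul_yonedaEval, proj_incl, μ.leibniz₀₁, d_remainder, hu,
    ← map_add, add_sub_cancel]

theorem splitMul_assoc {U V W : FGProj R} (x : X.X.obj U) (y : X.X.obj V) (z : X.X.obj W) :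
    (X.X.map (α_ U V W).hom).hom (splitMul hu (splitMul hu x y) z) =
      splitMul hu x (splitMul hu y z) := by
  induction z using splitting_induction (aug_eq_one_of_proj_eq_one hu) with
  | yonedaEval w =>
    rw [splitMul_yonedaEval, splitMul_yonedaEval, map_map_apply,
      FGProj.tensorRight_comp_associator, map_splitMul, map_id_apply]
  | incl c =>
    rw [splitMul_incl, splitMul_incl, splitMul_incl, map_incl, proj_splitMul, μ.assoc₀₀₁]
  | add z z' hz hz' => simp only [splitMul_add_right, map_add, hz, hz']

theorem unit_splitMul {V : FGProj R} (x : X.X.obj V) :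
    (X.X.map (λ_ V).hom).hom (splitMul hu u x) = x := by
  rw [splitMul_eq, remainder_self, map_zero, AddMonoidHom.zero_apply, map_zero, add_zero,
    map_map_apply, aug_eq_one_of_proj_eq_one hu, FGProj.tensorLeft_one_comp_leftUnitor,
    map_id_apply]

theorem splitMul_unit {V : FGProj R} (x : X.X.obj V) :
    (X.X.map (ρ_ V).hom).hom (splitMul hu x u) = x := by
  rw [splitMul, remainder_self, map_zero, map_zero, add_zero, map_map_apply,
    aug_eq_one_of_proj_eq_one hu, FGProj.tensorRight_one_comp_rightUnitor, map_id_apply]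

/-- The products `splitMul`, with the unit `u`, as a multiplicative structure on the functor `X`. -/
def splitFunctorMul : FunctorMul X.X where
  one := u
  mul _ _ := AddMonoidHom.mk'
    (fun x => AddMonoidHom.mk' (splitMul hu x) (splitMul_add_right hu x))
    (fun x x' => AddMonoidHom.ext fun y => splitMul_add_left hu x x' y)
  smul_mul _ _ s x y := (intHom (AddMonoidHom.mk' (splitMul hu · y)
    fun x x' => splitMul_add_left hu x x' y)).hom.map_smul s x
  mul_smul _ _ s x y := (intHom (AddMonoidHom.mk' (splitMul hu x)
    (splitMul_add_right hu x))).hom.map_smul s y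
  map_mul := map_splitMul hu
  assoc _ _ _ := splitMul_assoc hu
  one_mul _ := unit_splitMul hu
  mul_one _ := splitMul_unit hu

omit hu

variable (μ X) in
theorem nonempty_splitting_mul : Nonempty (X.Mul (μ.restrict (Int.castRingHom R))) := by
  obtain ⟨u, hu⟩ := exists_proj_eq X μ.one
  exact ⟨X.mulOfFunctorMul _ (splitFunctorMul hu) hu (fun _ _ => proj_splitMul hu)
    (fun _ _ => splitMul_incl hu) (fun _ _ => incl_splitMul hu)⟩

end SplitMul

section RegularRing

variable (ν : X.Mul (μ.restrict (Int.castRingHom R)))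

theorem mul_incl {V W : FGProj R} (x : X.X.obj V) (c : φ.C₁.obj W) :
    ν.mul V W x (incl X W c) = incl X (V ⊗ W) (μ.mul₀₁ V W (proj X V x) c) :=
  (ν.leibniz₀₁ V W x c).symm.trans (congrArg (incl X (V ⊗ W)) (ν.id_mul₀₁ V W x c))

theorem incl_mul {V W : FGProj R} (c : φ.C₁.obj V) (y : X.X.obj W) :
    ν.mul V W (incl X V c) y = incl X (V ⊗ W) (μ.mul₁₀ V W c (proj X W y)) :=
  (ν.leibniz₁₀ V W c y).symm.trans (congrArg (incl X (V ⊗ W)) (ν.id_mul₁₀ V W c y))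

theorem RegularOver.act_mul {f : End X.X} {r : R} (hf : RegularOver X f r) {V W : FGProj R}
    (x : X.X.obj V) (y : X.X.obj W) :
    ν.mul V W (act X f V x) y = act X f (V ⊗ W) (ν.mul V W x y) := by
  induction y using splitting_induction (aug_eq_one_of_proj_eq_one ν.c₀_one) with
  | yonedaEval w => rw [ν.mul_yonedaEval, ν.mul_yonedaEval, act_map]
  | incl c => rw [mul_incl, mul_incl, hf.2, hf.1, μ.smul_mul₀₁]
  | add y y' hy hy' => rw [map_add, map_add, map_add, hy, hy']

theorem RegularOver.mul_act {f : End X.X} {r : R} (hf : RegularOver X f r) {V W : FGProj R}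
    (x : X.X.obj V) (y : X.X.obj W) :
    ν.mul V W x (act X f W y) = act X f (V ⊗ W) (ν.mul V W x y) := by
  induction x using splitting_induction (aug_eq_one_of_proj_eq_one ν.c₀_one) with
  | yonedaEval v => rw [ν.yonedaEval_mul, ν.yonedaEval_mul, act_map]
  | incl c => rw [incl_mul, incl_mul, hf.2, hf.1, μ.mul₁₀_smul]
  | add x x' hx hx' =>
    rw [map_add, AddMonoidHom.add_apply, AddMonoidHom.add_apply, map_add, hx, hx']

include ν in
theorem regularRing_mul_comm (f g : regularRing X) : f * g = g * f := by
  have hf := regularProj_spec X f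
  have hg := regularProj_spec X g
  have hgf : RegularOver X (g.1 * f.1) (regularProj X f * regularProj X g) :=
    mul_comm (regularProj X g) _ ▸ hg.mul hf
  refine Subtype.ext ((hf.mul hg).ext (aug_eq_one_of_proj_eq_one ν.c₀_one) hgf ?_)
  have act_comm : act X (f.1 * g.1) _ (ν.mul _ _ ν.one ν.one) =
      act X (g.1 * f.1) _ (ν.mul _ _ ν.one ν.one) :=
    calc
      _ = ν.mul _ _ (act X f.1 _ ν.one) (act X g.1 _ ν.one) := by
        rw [act_mul, ← hg.mul_act ν, ← hf.act_mul ν]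
      _ = act X (g.1 * f.1) _ (ν.mul _ _ ν.one ν.one) := by
        rw [act_mul, ← hf.act_mul ν, ← hg.mul_act ν]
  have act_one_comm := congrArg (X.X.map (λ_ (𝟙_ (FGProj R))).hom).hom act_comm
  rwa [← act_map, ← act_map, ν.one_mul] at act_one_comm

/-- A multiplicative structure `ν` over `ℤ` on the splitting `X`, considered as a multiplicative
structure over `R'` with the same products. -/
def regularMul : (regularSplitting X).Mul (μ.restrict (regularProj X)) :=
  (regularSplitting X).mulOfFunctorMul _
    { one := ν.one
      mul := ν.mul
      smul_mul _ _ f x y := (regularProj_spec X f).act_mul ν x y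
      mul_smul _ _ f x y := (regularProj_spec X f).mul_act ν x y
      map_mul := ν.map_mul
      assoc := ν.assoc
      one_mul := ν.one_mul
      mul_one := ν.mul_one }
    ν.c₀_one ν.c₀_mul (fun _ _ => mul_incl ν) (fun _ _ => incl_mul ν)

end RegularRing

end RingElemExt

end

theorem mainTheorem6 (R : Type u) [CommRing R] (M : Type u) [AddCommGroup M] [Module R M]
    [Module Rᵐᵒᵖ M] [SMulCommClass R Rᵐᵒᵖ M]
    (φ : RingElemExt R M) (μ : φ.Mul (tautMul R)) :
    Nonempty φ.eStar.Splitting ∧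
    ∀ X : φ.eStar.Splitting,
      IsSquareZeroExtension (RingElemExt.regularIncl X) (RingElemExt.regularProj X) ∧
      (∀ x y : RingElemExt.regularRing X, x * y = y * x) ∧
      Nonempty (X.Mul (μ.restrict (Int.castRingHom R))) ∧
      ∀ ν : X.Mul (μ.restrict (Int.castRingHom R)),
        ∃ ν' : (RingElemExt.regularSplitting X).Mul (μ.restrict (RingElemExt.regularProj X)),
          ν'.one = ν.one ∧
          ∀ (V W : FGProj R) (x : X.X.obj V) (y : X.X.obj W), ν'.mul V W x y = ν.mul V W x y := by
  refine ⟨φ.nonempty_splitting, fun X => ?_⟩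
  have nonempty_mul := RingElemExt.nonempty_splitting_mul μ X
  exact ⟨RingElemExt.isSquareZeroExtension X, nonempty_mul.elim RingElemExt.regularRing_mul_comm,
    nonempty_mul, fun ν => ⟨RingElemExt.regularMul ν, rfl, fun _ _ _ _ => rfl⟩⟩
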